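/- **Setting.** Let $\mathcal{X}\subseteq\mathbb{R}^p$ ($p\ge 1$) be a feature space whose points all have last coordinate $1$ (the bias coordinate), $\mathcal{S}$ a space of sensitive attributes, $\mathcal{Y}=\{-1,1\}$, and $\mathcal{D}$ a probability distribution on $\mathcal{X}\times\mathcal{S}\times\mathcal{Y}$. For $\theta\in\mathbb{R}^p$ let $h=h_\theta(x)=\theta^\top x$, with prediction $\hat y(h,x)=1$ if $h(x)\ge 0$ and $-1$ otherwise, and let $\alpha(h,x,y)=y\,h(x)/\|x\|_2$ be the angular margin. Let $\tau_1,\dots,\tau_K$ be a partition of $\mathcal{X}\times\mathcal{S}\times\mathcal{Y}$ into measurable groups with $p_{k'}=\mathbf{P}_{\mathcal{D}}(\tau_{k'})>0$. For a distribution $Q$, let $Q_{k'}$ be its conditional distribution given $\tau_{k'}$. With $\mathcal{A}(h,Q)=\mathbf{P}_Q[\hat y(h,X)=Y]$ and $\Phi$ the standard normal distribution function, put, for constants $c=(c^0,\dots,c^K)$ and $\sigma>0$, $$F^c(h,Q)=c^0+\sum_{k'=1}^K c^{k'}\mathcal{A}(h,Q_{k'}),\qquad E^c(h,\sigma,Q)=c^0+\sum_{k'=1}^K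 c^{k'}\,\mathbf{E}_{Q_{k'}}\!\left[\Phi\!\left(\tfrac{\alpha(h,X,Y)}{\sigma}\right)\right],$$ $$V^c(h,\sigma,Q)=\Big[\sum_{k'=1}^K |c^{k'}|\sqrt{V_A(h,\sigma,Q_{k'})}\Big]^2,\qquad V_A(h,\sigma,Q)=\mathbf{E}_{Z^{(1)},Z^{(2)}\sim Q}\!\left[\Phi\!\left(\tfrac{\alpha^{\min}}{\sigma}\right)\Phi\!\left(\tfrac{-\alpha^{\max}}{\sigma}\right)\right],$$ where $Z^{(1)},Z^{(2)}$ are independent and $\alpha^{\min},\alpha^{\max}$ are the smaller and the larger of $\alpha(h,Z^{(1)})$ and $\alpha(h,Z^{(2)})$. Let $D$ be a dataset of $n$ i.i.d. samples from $\mathcal{D}$, with empirical distribution $\widehat{\mathcal{D}}$. For a group $k$ let $C_k=(C_k^0,\dots,C_k^K)$ be the constants of the fairness measure and $\widehat C_k=\widehat C_k(D)$ their estimates from $D$. Let $h=\mathcal{M}(D)$ be the linear model with parameter $\theta\in\mathbb{R}^p$ that an arbitrary mechanism $\mathcal{M}$ returns, and let $h^{\mathrm{priv}}$ be the linear model with parameter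 $\theta+\sigma\xi$, where $\xi\sim\mathcal{N}(0,I_p)$ is independent of $D$. Let $d_{\mathcal{H}}$ be the Natarajan dimension of the class of predictors $x\mapsto\hat y(h_\theta,x)$ on $\mathcal{X}$, $\theta\in\mathbb{R}^p$. **Lemma.** For all $B_3,B_4,s>0$ there are constants $A,a>0$, depending only on $B_3,B_4,s$, such that the following holds for every setting as above, every group $k$ with $\sum_{k'=1}^K|C_k^{k'}|\ge s$, and all $\sigma>0$ and $\kappa,\zeta\in(0,1)$. Assume that $$n\ \ge\ \frac{8\log((2K+1)/\kappa)}{\min_{k'}p_{k'}},\qquad n\ \ge\ a\log\frac{2K+1}{\kappa},$$ and that $\mathbf{P}_D\big(\sum_{k'=0}^K|C_k^{k'}-\widehat C_k^{k'}|>\alpha_C\big)\le B_3\exp(-B_4\alpha_C^2n)$ for every $\alpha_C>0$. Then, with probability at least $1-\kappa$ over $D$, it holds with probability at least $1-\zeta$ over the noise $\xi$ that $$\left|F^{C_k}(h^{\mathrm{priv}},\mathcal{D})-E^{\widehat C_k}(h,\sigma,\widehat{\mathcal{D}})\right|\ \le\ \sqrt{\frac{V^{\widehat C_k}(h,\sigma,\widehat{\mathcal{D}})}{\zeta}}+A\sum_{k'=1}^K|\widehat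 C_k^{k'}|\sqrt{\frac{d_{\mathcal{H}}+\log(K/\kappa)}{n\,p_{k'}}}.$$ -/

import Mathlib

open MeasureTheory ProbabilityTheory

noncomputable section

namespace DPFair

/-- The parameter space `ℝᵖ`, `p = m + 1`, with the Euclidean norm. -/
abbrev Param (m : ℕ) : Type := EuclideanSpace ℝ (Fin (m + 1))

/-- Data points `z = (x, s, y)` with `x ∈ 𝒳 ⊆ ℝᵖ`, sensitive attribute `s ∈ S` and label
`y ∈ {-1, 1}` (the units of `ℤ`). -/
abbrev Data {m : ℕ} (𝒳 : Set (Param m)) (S : Type*) : Type _ := 𝒳 × S × ℤˣ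

/-- The linear model `h_θ(x) = θᵀ x`. -/
def linModel {m : ℕ} (θ x : Param m) : ℝ := ∑ i, θ i * x i

open Classical in
/-- The predicted label: `1` if `h_θ(x) ≥ 0`, and `-1` otherwise. -/
def predict {m : ℕ} (θ x : Param m) : ℤˣ := if 0 ≤ linModel θ x then 1 else -1

/-- The signed margin `ρ(h, x, y) = y · h(x)`. -/
def margin {m : ℕ} (θ x : Param m) (y : ℤˣ) : ℝ := ((y : ℤ) : ℝ) * linModel θ x

/-- The angular margin `α(h, x, y) = ρ(h, x, y) / ‖x‖₂`. -/
def angMargin {m : ℕ} (θ x : Param m) (y : ℤˣ) : ℝ := margin θ x y / ‖x‖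

/-- The cumulative distribution function of the standard normal distribution. -/
def Phi (t : ℝ) : ℝ := cdf (gaussianReal 0 1) t

section

variable {m : ℕ} {𝒳 : Set (Param m)} {S : Type*} [MeasurableSpace S] {K : ℕ}

/-- The accuracy of the model `h_θ` over a distribution `P`. -/
def accuracy (θ : Param m) (P : Measure (Data 𝒳 S)) : ℝ :=
  P.real {z | predict θ z.1 = z.2.2}

/-- The fairness measure `c₀ + ∑_{k'=1}^K c_{k'} · accuracy(h_θ, P_{k'})`, where `P_{k'}` is the
conditional distribution of `P` given the group `τ_{k'}`. The constants of one fixed group `k` are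
the entries `c 0, c 1, …, c K`; the groups `1, …, K` are indexed by `Fin K`. -/
def fairness (c : Fin (K + 1) → ℝ) (τ : Fin K → Set (Data 𝒳 S)) (θ : Param m)
    (P : Measure (Data 𝒳 S)) : ℝ :=
  c 0 + ∑ k' : Fin K, c k'.succ * accuracy θ (cond P (τ k'))

/-- The expected accuracy `E_P[Φ(α(h, X, Y) / σ)]` of the perturbed models. -/
def expAccuracy (θ : Param m) (σ : ℝ) (P : Measure (Data 𝒳 S)) : ℝ :=
  ∫ z, Phi (angMargin θ z.1 z.2.2 / σ) ∂P

/-- The expected fairness of the perturbed models. -/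
def expFairness (c : Fin (K + 1) → ℝ) (τ : Fin K → Set (Data 𝒳 S)) (θ : Param m) (σ : ℝ)
    (P : Measure (Data 𝒳 S)) : ℝ :=
  c 0 + ∑ k' : Fin K, c k'.succ * expAccuracy θ σ (cond P (τ k'))

/-- The bound on the variance of the accuracy,
`E_{Z, Z' ∼ P}[Φ(α_min / σ) Φ(-α_max / σ)]`, where `α_min` and `α_max` are the smaller and the
larger of the angular margins at the two independent points `Z`, `Z'`. -/
def varAccuracy (θ : Param m) (σ : ℝ) (P : Measure (Data 𝒳 S)) : ℝ :=
  ∫ z, Phi (min (angMargin θ z.1.1 z.1.2.2) (angMargin θ z.2.1 z.2.2.2) / σ) *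
      Phi (-max (angMargin θ z.1.1 z.1.2.2) (angMargin θ z.2.1 z.2.2.2) / σ) ∂(P.prod P)

/-- The bound on the variance of the fairness. -/
def varFairness (c : Fin (K + 1) → ℝ) (τ : Fin K → Set (Data 𝒳 S)) (θ : Param m) (σ : ℝ)
    (P : Measure (Data 𝒳 S)) : ℝ :=
  (∑ k' : Fin K, |c k'.succ| * √(varAccuracy θ σ (cond P (τ k')))) ^ 2

/-- The empirical distribution `(1/n) ∑ᵢ δ_{zᵢ}` of a dataset. -/
def empirical {n : ℕ} (D : Fin n → Data 𝒳 S) : Measure (Data 𝒳 S) :=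
  (n : ENNReal)⁻¹ • ∑ i, Measure.dirac (D i)

/-- The law of a dataset of `n` independent samples from `P`. -/
def sampleLaw (n : ℕ) (P : Measure (Data 𝒳 S)) : Measure (Fin n → Data 𝒳 S) :=
  Measure.pi fun _ => P

/-- `τ` is a partition of the data space into `K` measurable groups. -/
structure IsGroupPartition (τ : Fin K → Set (Data 𝒳 S)) : Prop where
  measurableSet : ∀ k, MeasurableSet (τ k)
  disjoint : Pairwise fun k l => Disjoint (τ k) (τ l)
  iUnion_eq : ⋃ k, τ k = Set.univ

end

/-- A finite set `B` is shattered, in the sense of Natarajan, by the class `H`. -/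
def NatarajanShatters {α β : Type*} (H : Set (α → β)) (B : Finset α) : Prop :=
  ∃ f₀ f₁ : α → β, (∀ x ∈ B, f₀ x ≠ f₁ x) ∧
    ∀ T ⊆ B, ∃ h ∈ H, ∀ x ∈ B, (x ∈ T → h x = f₀ x) ∧ (x ∉ T → h x = f₁ x)

/-- The Natarajan dimension: the largest size of a shattered finite set. -/
def natarajanDim {α β : Type*} (H : Set (α → β)) : ℕ∞ :=
  ⨆ B : {B : Finset α // NatarajanShatters H B}, (B.1.card : ℕ∞)

/-- The class of the predictors on `𝒳` that the linear models define. -/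
def linClass {m : ℕ} (𝒳 : Set (Param m)) : Set (𝒳 → ℤˣ) :=
  Set.range fun (θ : Param m) (x : 𝒳) => predict θ x

/-- The Natarajan dimension of the class of linear models on `𝒳 ⊆ ℝᵖ`, as a number (it is at
most `p`, hence finite). -/
def linDim {m : ℕ} (𝒳 : Set (Param m)) : ℝ := ((natarajanDim (linClass 𝒳)).toNat : ℝ)

/-- With probability at least `1 - δ` over `ω ∼ μ`, `p ω` holds: some event of that probability
lies in `{ω | p ω}`, which need not be assumed measurable. -/
def WithProb {Ω : Type*} [MeasurableSpace Ω] (μ : Measure Ω) (δ : ℝ) (p : Ω → Prop) : Prop :=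
  ∃ G : Set Ω, MeasurableSet G ∧ 1 - δ ≤ μ.real G ∧ ∀ ω ∈ G, p ω

end DPFair

end

/-!
The difference between the fairness of the released model over `P` and the empirical expected
fairness splits into three parts: replacing the constants by their estimates, replacing `P` by the
empirical distribution `P̂` with the released model kept fixed, and replacing the accuracy of the
released model over `P̂` by its mean over the noise.

* Accuracies lie in `[0, 1]`, so the first part is at most the sum of the errors of the estimated
  constants, to which the assumed tail bound applies. Since the absolute values of the true
  constants have sum at least `s` and `n` is large, those of the estimates have sum at least
  `s / 2`, and this part is absorbed into the last term of the asserted bound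
  (`mul_exp_tail_le` gives the constants).
* The second part has to be bounded uniformly over all models, because the mechanism is arbitrary
  and may use all of the data. The rate `√(d / n)` contains no factor `log n`, so a union bound over
  the traces of the class on the sample does not suffice. Exponential symmetrization
  (`integral_exp_norm_sum_le_symmetrized`) reduces the centred indicators of a group to a Rademacher
  process indexed by the traces; conditionally on the sample this process only involves the points
  in the group, whose number is binomial (`integral_exp_card_hits_le`). The process is controlled by
  chaining (`rademacher_chaining`) over nets whose size is bounded by Dudley's packing lemma
  (`log_card_le_of_separated`), a consequence of the Sauer–Shelah lemma. Working with exponential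
  moments throughout makes conditioning on the group sizes unnecessary. The bias coordinate reduces
  the uncountable class of models to a countable one (`exists_seq_predict_eventually_eq`). The VC
  dimension of the traces is at most the Natarajan dimension (`tracesVCDimLE_correct`), which is a
  genuine finite number (`card_le_of_natarajanShatters`).
* The third part is Chebyshev's inequality: at a fixed point the perturbed model is correct with
  probability `Φ(α / σ)`, and the variance of the accuracy is an integral over pairs of points of
  the covariances of two such events, each at most `Φ(α_min / σ) Φ(-α_max / σ)`
  (`integral_sq_accuracy_sub_le`); the triangle inequality in `L²` combines the groups.
-/

noncomputable section

namespace DPFair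

/-! ### Packing numbers of families of bounded VC dimension -/

open Finset in
/-- A form of the Sauer–Shelah bound: weighting the shattered sets `s` by `x ^ #s` and summing over
all subsets of the ground set bounds the size of the family by `((1 + x) ^ m) / x ^ d`. -/
lemma card_mul_pow_le_of_shatters {α : Type*} [Fintype α] [DecidableEq α] (𝒜 : Finset (Finset α))
    {d : ℕ} (hd : ∀ B, 𝒜.Shatters B → #B ≤ d) {x : ℝ} (hx0 : 0 ≤ x) (hx1 : x ≤ 1) :
    (#𝒜 : ℝ) * x ^ d ≤ (1 + x) ^ Fintype.card α := by
  calc (#𝒜 : ℝ) * x ^ d ≤ #𝒜.shatterer * x ^ d := by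
        have := 𝒜.card_le_card_shatterer
        gcongr
    _ = ∑ s ∈ 𝒜.shatterer, x ^ d := by simp
    _ ≤ ∑ s ∈ 𝒜.shatterer, x ^ #s := Finset.sum_le_sum fun s hs =>
        pow_le_pow_of_le_one hx0 hx1 (hd s (mem_shatterer.1 hs))
    _ ≤ ∑ s : Finset α, x ^ #s :=
        Finset.sum_le_sum_of_subset_of_nonneg (subset_univ _) fun s _ _ => by positivity
    _ = (1 + x) ^ Fintype.card α := by
        rw [add_comm, ← Fintype.sum_pow_mul_eq_add_pow]
        simp

open Finset in
/-- A family of subsets of `I` whose members are pairwise at Hamming distance more than `η #I` is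
told apart by a multiset of about `2 log #T / η` points of `I`: a uniformly random choice of points
works with positive probability. -/
lemma exists_separating_points {ι : Type*} [DecidableEq ι] {T : Finset (Finset ι)}
    {I : Finset ι} {η : ℝ} (hI : I.Nonempty) (hT : T.Nonempty) (hTI : ∀ t ∈ T, t ⊆ I)
    (hsep : ∀ t ∈ T, ∀ t' ∈ T, t ≠ t' → η * #I < #(symmDiff t t'))
    {m : ℕ} (hm : (#T : ℝ) ^ 2 ≤ Real.exp (η * m)) :
    ∃ φ : Fin m → ι, ∀ t ∈ T, ∀ t' ∈ T, (∀ i, φ i ∈ t ↔ φ i ∈ t') → t = t' := by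
  by_contra! hcon
  have hNpos : (0 : ℝ) < #I := by exact_mod_cast hI.card_pos
  have hsub : Fintype.piFinset (fun _ : Fin m => I) ⊆
      T.offDiag.biUnion fun q => Fintype.piFinset fun _ : Fin m => I \ symmDiff q.1 q.2 := by
    intro φ hφ
    obtain ⟨t, ht, t', ht', heq, hne⟩ := hcon φ
    refine mem_biUnion.2 ⟨(t, t'), mem_offDiag.2 ⟨ht, ht', hne⟩, Fintype.mem_piFinset.2 fun i => ?_⟩
    have := heq i
    refine mem_sdiff.2 ⟨Fintype.mem_piFinset.1 hφ i, ?_⟩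
    simp only [mem_symmDiff]
    tauto
  have hcard : ((#I : ℝ) ^ m) ≤ ∑ q ∈ T.offDiag, ((#I : ℝ) * Real.exp (-η)) ^ m := by
    have h1 := (card_le_card hsub).trans card_biUnion_le
    simp only [Fintype.card_piFinset_const] at h1
    have h2 : ((#I : ℝ) ^ m) ≤ ∑ q ∈ T.offDiag, ((#(I \ symmDiff q.1 q.2) : ℝ)) ^ m := by
      exact_mod_cast h1
    refine h2.trans (Finset.sum_le_sum fun q hq => ?_)
    obtain ⟨ht, ht', hne⟩ := mem_offDiag.1 hq
    refine pow_le_pow_left₀ (by positivity) ?_ _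
    have hs : symmDiff q.1 q.2 ⊆ I := fun i hi => by
      rcases mem_symmDiff.1 hi with h | h
      · exact hTI _ ht h.1
      · exact hTI _ ht' h.1
    rw [cast_card_sdiff hs]
    have := hsep _ ht _ ht' hne
    nlinarith [Real.add_one_le_exp (-η)]
  rw [sum_const, nsmul_eq_mul, mul_pow, ← Real.exp_nat_mul] at hcard
  have hoff : (#T.offDiag : ℝ) < (#T : ℝ) ^ 2 := by
    rw [offDiag_card]
    have : 0 < #T := hT.card_pos
    have h3 : #T * #T - #T < #T ^ 2 := by
      rw [sq]; exact Nat.sub_lt (by positivity) this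
    exact_mod_cast h3
  have h4 : (#T.offDiag : ℝ) * Real.exp (m * -η) < 1 := by
    rw [show (m : ℝ) * -η = -(η * m) by ring, Real.exp_neg, ← div_eq_mul_inv,
      div_lt_one (Real.exp_pos _)]
    linarith
  have h5 : (0 : ℝ) < (#I : ℝ) ^ m := by positivity
  nlinarith

open Finset in
/-- Dudley's packing bound: an `η`-separated family of VC dimension at most `d` has logarithmic
size at most of order `d log (1 / η)`. The family is told apart on `m ≈ 2 log #T / η` points, and
the Sauer–Shelah bound on these points with weight `η / 8` gives an inequality for `log #T` that
can be solved. -/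
lemma log_card_le_of_separated {ι : Type*} [DecidableEq ι] {T : Finset (Finset ι)}
    {I : Finset ι} {η : ℝ} (hη0 : 0 < η) (hη1 : η ≤ 1) (hTI : ∀ t ∈ T, t ⊆ I)
    (hsep : ∀ t ∈ T, ∀ t' ∈ T, t ≠ t' → η * #I < #(symmDiff t t'))
    {d : ℕ} (hd1 : 1 ≤ d) (hd : ∀ B, T.Shatters B → #B ≤ d) :
    Real.log #T ≤ 2 * d * Real.log (8 / η) := by
  have hlog8 : 1 ≤ Real.log (8 / η) := by
    rw [Real.le_log_iff_exp_le (by positivity)]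
    have := Real.exp_one_lt_d9
    have h8 : (8 : ℝ) ≤ 8 / η := by rw [le_div_iff₀ hη0]; linarith
    linarith
  have hd1' : (1 : ℝ) ≤ d := by exact_mod_cast hd1
  rcases le_or_gt #T 1 with h1 | h1
  · have : Real.log #T ≤ 0 := Real.log_nonpos (by positivity) (by exact_mod_cast h1)
    have h2 : 0 ≤ 2 * d * Real.log (8 / η) := by positivity
    linarith
  have hTne : T.Nonempty := card_pos.1 (by omega)
  have hI : I.Nonempty := by
    obtain ⟨t, ht, t', ht', hne⟩ := one_lt_card.1 h1
    by_contra hI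
    rw [not_nonempty_iff_eq_empty] at hI
    have h2 := hTI t ht
    have h3 := hTI t' ht'
    rw [hI, subset_empty] at h2 h3
    exact hne (h2.trans h3.symm)
  set ℓ := Real.log #T with hℓ
  have hTpos : (0 : ℝ) < #T := by exact_mod_cast hTne.card_pos
  have hℓ0 : 0 ≤ ℓ := Real.log_nonneg (by exact_mod_cast h1.le)
  have hexp : Real.exp ℓ = #T := Real.exp_log hTpos
  set m := ⌈2 * ℓ / η⌉₊ with hmdef
  have hm1 : 2 * ℓ ≤ η * m := by
    have := Nat.le_ceil (2 * ℓ / η)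
    rw [div_le_iff₀ hη0] at this
    linarith
  have hm2 : η * m ≤ 2 * ℓ + 1 := by
    have := (Nat.ceil_lt_add_one (show 0 ≤ 2 * ℓ / η by positivity)).le
    calc η * m ≤ η * (2 * ℓ / η + 1) := by gcongr
      _ = 2 * ℓ + η := by field_simp
      _ ≤ _ := by linarith
  obtain ⟨φ, hφ⟩ := exists_separating_points (m := m) hI hTne hTI hsep (by
    rw [← hexp, ← Real.exp_nat_mul]
    exact Real.exp_le_exp.2 (by push_cast; exact hm1))
  -- the traces of the family on the `m` points
  let tr : Finset ι → Finset (Fin m) := fun t => univ.filter fun i => φ i ∈ t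
  have hinj : Set.InjOn tr T := fun t ht t' ht' h => hφ t ht t' ht' fun i => by
    have := congrArg (i ∈ ·) h
    simpa [tr] using this
  have hcard : #(T.image tr) = #T := card_image_of_injOn hinj
  have hshat : ∀ B, (T.image tr).Shatters B → #B ≤ d := by
    intro B hB
    have hφB : Set.InjOn φ B := by
      intro i hi j hj hij
      by_contra hne
      obtain ⟨u, hu, hui⟩ := hB.exists_inter_eq_singleton hi
      obtain ⟨t, ht, rfl⟩ := mem_image.1 hu
      have h1 : i ∈ B ∩ tr t := by rw [hui]; simp
      have h2 : j ∉ B ∩ tr t := by rw [hui]; simpa using fun h => hne h.symm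
      simp only [mem_inter, tr, mem_filter, mem_univ, true_and] at h1 h2
      exact h2 ⟨hj, hij ▸ h1.2⟩
    rw [← card_image_of_injOn hφB]
    refine hd _ fun s hs => ?_
    obtain ⟨u, hu, hus⟩ := hB (t := B.filter fun i => φ i ∈ s) (filter_subset _ _)
    obtain ⟨t, ht, rfl⟩ := mem_image.1 hu
    refine ⟨t, ht, ?_⟩
    ext a
    constructor
    · intro ha
      obtain ⟨ha1, ha2⟩ := mem_inter.1 ha
      obtain ⟨i, hi, rfl⟩ := mem_image.1 ha1
      have : i ∈ B ∩ tr t := by simp [tr, hi, ha2]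
      rw [hus] at this
      exact (mem_filter.1 this).2
    · intro ha
      obtain ⟨i, hi, rfl⟩ := mem_image.1 (hs ha)
      have : i ∈ B ∩ tr t := by rw [hus]; exact mem_filter.2 ⟨hi, ha⟩
      simp only [tr, mem_inter, mem_filter, mem_univ, true_and] at this
      exact mem_inter.2 ⟨hs ha, this.2⟩
  have key := card_mul_pow_le_of_shatters (T.image tr) hshat (x := η / 8) (by positivity)
    (by linarith)
  rw [hcard, Fintype.card_fin] at key
  have key2 : (#T : ℝ) * (η / 8) ^ d ≤ Real.exp (η * m / 8) := by
    refine key.trans ?_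
    calc (1 + η / 8) ^ m ≤ (Real.exp (η / 8)) ^ m := by
          gcongr
          linarith [Real.add_one_le_exp (η / 8)]
      _ = _ := by rw [← Real.exp_nat_mul]; ring_nf
  have key3 := Real.log_le_log (by positivity) key2
  rw [Real.log_exp, Real.log_mul hTpos.ne' (by positivity), Real.log_pow] at key3
  have hneg : Real.log (η / 8) = -Real.log (8 / η) := by
    rw [← Real.log_inv, inv_div]
  rw [hneg] at key3
  nlinarith

open Finset in
/-- A maximal `r`-separated subfamily of a finite family of finite sets is an `r`-net. -/
lemma exists_net {ι : Type*} [DecidableEq ι] (T : Finset (Finset ι)) (r : ℝ) (hr : 0 ≤ r) :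
    ∃ N ⊆ T, (∀ t ∈ N, ∀ t' ∈ N, t ≠ t' → r < #(symmDiff t t')) ∧
      ∀ t ∈ T, ∃ t' ∈ N, (#(symmDiff t t') : ℝ) ≤ r := by
  classical
  let 𝒮 := T.powerset.filter fun N => ∀ t ∈ N, ∀ t' ∈ N, t ≠ t' → r < #(symmDiff t t')
  obtain ⟨N, hN, hmax⟩ := exists_max_image 𝒮 card ⟨∅, by simp [𝒮]⟩
  simp only [𝒮, mem_filter, mem_powerset] at hN hmax
  refine ⟨N, hN.1, hN.2, fun t ht => ?_⟩
  by_contra! hfar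
  have htN : t ∉ N := fun h => by
    have := hfar t h
    simp only [symmDiff_self, bot_eq_empty, card_empty, Nat.cast_zero] at this
    linarith
  have := hmax (insert t N) ⟨insert_subset ht hN.1, by
    intro a ha b hb hab
    rcases mem_insert.1 ha with rfl | ha' <;> rcases mem_insert.1 hb with rfl | hb'
    · exact absurd rfl hab
    · exact hfar b hb'
    · rw [symmDiff_comm]; exact hfar a ha'
    · exact hN.2 a ha' b hb' hab⟩
  rw [card_insert_of_notMem htN] at this
  omega

/-! ### Chaining for the Rademacher process -/

/-- The sign `1` or `-1` that a Boolean stands for. -/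
def sgn (b : Bool) : ℝ := if b then 1 else -1

/-- The moment generating function of a Rademacher sum, as a sum over all sign patterns. -/
lemma sum_exp_rademacher_le {ι : Type*} [Fintype ι] [DecidableEq ι] (a : ι → ℝ) :
    ∑ ε : ι → Bool, Real.exp (∑ i, sgn (ε i) * a i) ≤
      2 ^ Fintype.card ι * Real.exp ((∑ i, a i ^ 2) / 2) := by
  have h1 : ∑ ε : ι → Bool, Real.exp (∑ i, sgn (ε i) * a i) =
      ∏ i, ∑ b : Bool, Real.exp (sgn b * a i) := by
    rw [Finset.prod_univ_sum, Fintype.piFinset_univ]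
    simp_rw [Real.exp_sum]
  rw [h1, Finset.sum_div, Real.exp_sum, ← Finset.card_univ, ← Finset.prod_const,
    ← Finset.prod_mul_distrib]
  refine Finset.prod_le_prod (fun i _ => by positivity) fun i _ => ?_
  have := Real.cosh_le_exp_half_sq (a i)
  rw [Real.cosh_eq] at this
  simp only [Fintype.univ_bool, sgn, Finset.mem_singleton, Bool.true_eq_false, not_false_eq_true,
    Finset.sum_insert, if_true, Finset.sum_singleton, Bool.false_eq_true, if_false, one_mul,
    neg_mul]
  linarith

/-- The sum of the signs over a set of indices. -/
def signSum {ι : Type*} (ε : ι → Bool) (t : Finset ι) : ℝ := ∑ i ∈ t, sgn (ε i)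

open Finset in
/-- The increments of the Rademacher process are subgaussian for the Hamming distance. -/
lemma sum_exp_signSum_sub_le {ι : Type*} [Fintype ι] [DecidableEq ι] (t t' : Finset ι) (μ : ℝ) :
    ∑ ε : ι → Bool, Real.exp (μ * |signSum ε t - signSum ε t'|) ≤
      2 * 2 ^ Fintype.card ι * Real.exp (μ ^ 2 * #(symmDiff t t') / 2) := by
  let c : ι → ℝ := fun i => (if i ∈ t then 1 else 0) - (if i ∈ t' then 1 else 0)
  have hc : ∑ i, c i ^ 2 = #(symmDiff t t') := by
    rw [card_eq_sum_ones, Nat.cast_sum, ← sum_filter_add_sum_filter_not univ (· ∈ symmDiff t t')]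
    have h1 : ∑ i ∈ univ.filter (fun i => i ∉ symmDiff t t'), c i ^ 2 = 0 := by
      refine sum_eq_zero fun i hi => ?_
      have : i ∉ symmDiff t t' := (mem_filter.1 hi).2
      rw [mem_symmDiff] at this
      by_cases h : i ∈ t <;> by_cases h' : i ∈ t' <;> simp_all [c]
    rw [h1, add_zero, filter_mem_eq_inter, univ_inter]
    refine sum_congr rfl fun i hi => ?_
    rw [mem_symmDiff] at hi
    by_cases h : i ∈ t <;> by_cases h' : i ∈ t' <;> simp_all [c]
  have hX : ∀ ε : ι → Bool, signSum ε t - signSum ε t' = ∑ i, sgn (ε i) * c i := by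
    intro ε
    simp [signSum, c, mul_sub, sum_sub_distrib]
  have hsq : ∀ ν : ℝ, ∑ i, (ν * c i) ^ 2 = ν ^ 2 * #(symmDiff t t') := by
    intro ν
    simp_rw [mul_pow]
    rw [← mul_sum, hc]
  have hle : ∀ ε : ι → Bool, Real.exp (μ * |signSum ε t - signSum ε t'|) ≤
      Real.exp (∑ i, sgn (ε i) * (μ * c i)) + Real.exp (∑ i, sgn (ε i) * (-μ * c i)) := by
    intro ε
    have e1 : ∑ i, sgn (ε i) * (μ * c i) = μ * (signSum ε t - signSum ε t') := by
      rw [hX, mul_sum]; exact sum_congr rfl fun i _ => by ring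
    have e2 : ∑ i, sgn (ε i) * (-μ * c i) = -(μ * (signSum ε t - signSum ε t')) := by
      rw [hX, mul_sum, ← sum_neg_distrib]; exact sum_congr rfl fun i _ => by ring
    rw [e1, e2]
    rcases abs_cases (signSum ε t - signSum ε t') with h | h
    · rw [h.1]; linarith [Real.exp_pos (-(μ * (signSum ε t - signSum ε t')))]
    · rw [h.1, mul_neg]; linarith [Real.exp_pos (μ * (signSum ε t - signSum ε t'))]
  calc _ ≤ ∑ ε : ι → Bool, (Real.exp (∑ i, sgn (ε i) * (μ * c i)) +
        Real.exp (∑ i, sgn (ε i) * (-μ * c i))) := sum_le_sum fun ε _ => hle ε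
    _ ≤ _ := by
      rw [sum_add_distrib]
      have h1 := sum_exp_rademacher_le fun i => μ * c i
      have h2 := sum_exp_rademacher_le fun i => -μ * c i
      rw [hsq] at h1 h2
      rw [neg_sq] at h2
      linarith

lemma sum_weight_mul_le (J : ℕ) :
    ∑ j ∈ Finset.range J, (1 / 2 : ℝ) ^ (j + 1) * (2 * (j + 1) + 3) ≤ 7 := by
  have : ∀ J : ℕ, ∑ j ∈ Finset.range J, (1 / 2 : ℝ) ^ (j + 1) * (2 * (j + 1) + 3) =
      7 - (2 * J + 7) * (1 / 2) ^ J := by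
    intro J
    induction J with
    | zero => simp
    | succ J ih => rw [Finset.sum_range_succ, ih]; push_cast; ring
  rw [this]
  have : (0 : ℝ) ≤ (2 * J + 7) * (1 / 2) ^ J := by positivity
  linarith

lemma sum_weight (J : ℕ) :
    ∑ j ∈ Finset.range J, (1 / 2 : ℝ) ^ (j + 1) = 1 - (1 / 2) ^ J := by
  induction J with
  | zero => simp
  | succ J ih => rw [Finset.sum_range_succ, ih]; ring

open Finset in
/-- Convexity of the exponential with the weights `2⁻¹, …, 2⁻ᴶ`, the remaining mass being put
at `0`. -/
lemma exp_weighted_sum_le (J : ℕ) (y : ℕ → ℝ) :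
    Real.exp (∑ j ∈ range J, (1 / 2 : ℝ) ^ (j + 1) * y j) ≤
      (1 / 2) ^ J + ∑ j ∈ range J, (1 / 2 : ℝ) ^ (j + 1) * Real.exp (y j) := by
  induction J generalizing y with
  | zero => simp
  | succ J ih =>
    rw [sum_range_succ', sum_range_succ']
    have h1 : ∑ j ∈ range J, (1 / 2 : ℝ) ^ (j + 1 + 1) * y (j + 1) =
        (1 / 2) * ∑ j ∈ range J, (1 / 2 : ℝ) ^ (j + 1) * y (j + 1) := by
      rw [mul_sum]; exact sum_congr rfl fun j _ => by ring
    have h2 : ∑ j ∈ range J, (1 / 2 : ℝ) ^ (j + 1 + 1) * Real.exp (y (j + 1)) =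
        (1 / 2) * ∑ j ∈ range J, (1 / 2 : ℝ) ^ (j + 1) * Real.exp (y (j + 1)) := by
      rw [mul_sum]; exact sum_congr rfl fun j _ => by ring
    rw [h1, h2]
    have h3 := convexOn_exp.2 (Set.mem_univ (∑ j ∈ range J, (1 / 2 : ℝ) ^ (j + 1) * y (j + 1)))
      (Set.mem_univ (y 0)) (show (0 : ℝ) ≤ 1 / 2 by norm_num) (show (0 : ℝ) ≤ 1 / 2 by norm_num)
      (by norm_num)
    simp only [smul_eq_mul] at h3
    have h4 := ih fun j => y (j + 1)
    simp only [zero_add, pow_succ] at h3 h4 ⊢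
    linarith

open Finset in
/-- Successive nets of a family of subsets of `I` with VC dimension at most `d`: the net at level
`j ≥ 1` is `4⁻ʲ #I`-separated and `4⁻ʲ #I`-dense; at level `0` it is `{∅}`. The map `π j` sends a
set to a nearby member of the net at level `j`. -/
lemma exists_nets {ι : Type*} [DecidableEq ι] {T : Finset (Finset ι)} (hT : T.Nonempty)
    {I : Finset ι} (hTI : ∀ t ∈ T, t ⊆ I) {d : ℕ} (hd1 : 1 ≤ d)
    (hd : ∀ B, T.Shatters B → #B ≤ d) :
    ∃ (N : ℕ → Finset (Finset ι)) (π : ℕ → Finset ι → Finset ι), N 0 = {∅} ∧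
      (∀ j, (N (j + 1)).Nonempty) ∧
      (∀ j, Real.log #(N (j + 1)) ≤ 2 * d * Real.log (8 * 4 ^ (j + 1))) ∧
      (∀ j, ∀ t ∈ N (j + 1), π j t ∈ N j ∧ (#(symmDiff t (π j t)) : ℝ) ≤ (1 / 4) ^ j * #I) ∧
      ∃ J, T ⊆ N J := by
  choose N' hN'T hN'sep hN'net using fun j : ℕ =>
    exists_net T ((1 / 4) ^ j * #I) (by positivity)
  let N : ℕ → Finset (Finset ι) := fun j => if j = 0 then {∅} else N' j
  have hN : ∀ j, N (j + 1) = N' (j + 1) := fun j => by simp [N]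
  have hNT : ∀ j, N (j + 1) ⊆ T := fun j => by rw [hN]; exact hN'T _
  have hπ : ∀ j, ∀ t, ∃ t', t ∈ N (j + 1) →
      t' ∈ N j ∧ (#(symmDiff t t') : ℝ) ≤ (1 / 4) ^ j * #I := by
    intro j t
    by_cases ht : t ∈ N (j + 1)
    · rcases j with _ | j
      · refine ⟨∅, fun _ => ⟨by simp [N], ?_⟩⟩
        have := card_le_card (hTI t (hNT 0 ht))
        simpa [symmDiff] using this
      · obtain ⟨t', ht', h⟩ := hN'net (j + 1) t (hNT _ ht)
        exact ⟨t', fun _ => ⟨by rw [hN]; exact ht', h⟩⟩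
    · exact ⟨∅, fun h => absurd h ht⟩
  choose π hπ using hπ
  refine ⟨N, π, by simp [N], fun j => ?_, fun j => ?_, hπ, ?_⟩
  · obtain ⟨t, ht⟩ := hT
    obtain ⟨t', ht', -⟩ := hN'net (j + 1) t ht
    exact ⟨t', by rw [hN]; exact ht'⟩
  · have h := log_card_le_of_separated (T := N' (j + 1)) (I := I) (η := (1 / 4) ^ (j + 1))
      (by positivity) (pow_le_one₀ (by norm_num) (by norm_num))
      (fun t ht => hTI t (hN'T _ ht)) (hN'sep (j + 1)) hd1
      (fun B hB => hd B (hB.mono_left (hN'T _)))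
    rw [hN]
    convert h using 3
    rw [one_div, inv_pow, div_inv_eq_mul]
  · -- at a level with `4⁻ʲ #I < 1` the net is everything
    obtain ⟨J, hJ⟩ := exists_pow_lt_of_lt_one (show (0 : ℝ) < 1 / (#I + 1) by positivity)
      (show (1 / 4 : ℝ) < 1 by norm_num)
    refine ⟨J + 1, fun t ht => ?_⟩
    obtain ⟨t', ht', h⟩ := hN'net (J + 1) t ht
    have h1 : (#(symmDiff t t') : ℝ) < 1 := by
      rw [lt_div_iff₀ (by positivity)] at hJ
      have h0 : (0 : ℝ) ≤ #I := by positivity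
      have h2 : (0 : ℝ) < (1 / 4) ^ J := by positivity
      rw [pow_succ] at h
      nlinarith
    have h2 : #(symmDiff t t') = 0 := by
      have : #(symmDiff t t') < 1 := by exact_mod_cast h1
      omega
    have h3 : t = t' := symmDiff_eq_bot.1 (card_eq_zero.1 h2)
    rw [hN, h3]
    exact ht'

open Finset in
/-- Chaining for the Rademacher process on a family of VC dimension at most `d`, without a
logarithmic factor: one function `R` of the signs dominates `exp (lam |∑_{i ∈ t} εᵢ|)` for all
members `t` of the family at once, and its mean is at most `exp (11 d + 2 lam² #I)`. The increments
at level `j` have variance `4⁻ʲ #I` and get the weight `2⁻ʲ⁻¹` in the convexity inequality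
`exp_weighted_sum_le`, so that the variance terms and the entropies `2 d (2 j + 5) log 2` both have
a bounded weighted sum. -/
theorem rademacher_chaining {ι : Type*} [Fintype ι] [DecidableEq ι] {T : Finset (Finset ι)}
    (hT : T.Nonempty) {I : Finset ι} (hTI : ∀ t ∈ T, t ⊆ I) {d : ℕ} (hd1 : 1 ≤ d)
    (hd : ∀ B, T.Shatters B → #B ≤ d) {lam : ℝ}
    (hlam : 0 ≤ lam) :
    ∃ R : (ι → Bool) → ℝ, (∀ ε, ∀ t ∈ T, Real.exp (lam * |signSum ε t|) ≤ R ε) ∧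
      ∑ ε, R ε ≤ 2 ^ Fintype.card ι * Real.exp (11 * d + 2 * lam ^ 2 * #I) := by
  obtain ⟨N, π, hN0, hNne, hNlog, hπ, J, hJ⟩ := exists_nets hT hTI hd1 hd
  let μ : ℕ → ℝ := fun j => lam * 2 ^ (j + 1)
  let G : ℕ → (ι → Bool) → ℝ := fun j ε =>
    ∑ t ∈ N (j + 1), Real.exp (μ j * |signSum ε t - signSum ε (π j t)|)
  have hGpos : ∀ j ε, 0 < G j ε := fun j ε =>
    sum_pos (fun t _ => Real.exp_pos _) (hNne j)
  have hchain : ∀ ε, ∀ j, ∀ t ∈ N j,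
      lam * |signSum ε t| ≤ ∑ i ∈ range j, (1 / 2 : ℝ) ^ (i + 1) * Real.log (G i ε) := by
    intro ε j
    induction j with
    | zero =>
      intro t ht
      rw [hN0, mem_singleton] at ht
      simp [ht, signSum]
    | succ j ih =>
      intro t ht
      have h1 := ih (π j t) (hπ j t ht).1
      have h2 : μ j * |signSum ε t - signSum ε (π j t)| ≤ Real.log (G j ε) := by
        rw [Real.le_log_iff_exp_le (hGpos j ε)]
        exact single_le_sum (f := fun t => Real.exp (μ j * |signSum ε t - signSum ε (π j t)|))
          (fun t _ => (Real.exp_pos _).le) ht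
      have h3 : |signSum ε t| ≤ |signSum ε (π j t)| + |signSum ε t - signSum ε (π j t)| := by
        have := abs_add_le (signSum ε (π j t)) (signSum ε t - signSum ε (π j t))
        rwa [add_sub_cancel] at this
      have h4 : lam * |signSum ε t - signSum ε (π j t)| =
          (1 / 2 : ℝ) ^ (j + 1) * (μ j * |signSum ε t - signSum ε (π j t)|) := by
        have : (1 / 2 : ℝ) ^ (j + 1) * 2 ^ (j + 1) = 1 := by rw [← mul_pow]; norm_num
        simp only [μ]
        linear_combination (-lam * |signSum ε t - signSum ε (π j t)|) * this
      rw [sum_range_succ]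
      calc lam * |signSum ε t|
          ≤ lam * (|signSum ε (π j t)| + |signSum ε t - signSum ε (π j t)|) := by gcongr
        _ ≤ _ := by
          rw [mul_add, h4]
          gcongr
  -- the logarithm of the mean of `G j` is at most `L j`
  let L : ℕ → ℝ := fun j => Real.log 2 + Real.log #(N (j + 1)) + 2 * lam ^ 2 * #I
  have hGsum : ∀ j, ∑ ε, G j ε ≤ 2 ^ Fintype.card ι * Real.exp (L j) := by
    intro j
    have hNpos : (0 : ℝ) < #(N (j + 1)) := by exact_mod_cast (hNne j).card_pos
    calc ∑ ε, G j ε = ∑ t ∈ N (j + 1), ∑ ε : ι → Bool,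
          Real.exp (μ j * |signSum ε t - signSum ε (π j t)|) := sum_comm
      _ ≤ ∑ t ∈ N (j + 1), 2 * 2 ^ Fintype.card ι * Real.exp (2 * lam ^ 2 * #I) := by
          refine sum_le_sum fun t ht => (sum_exp_signSum_sub_le _ _ _).trans ?_
          gcongr
          have h1 := (hπ j t ht).2
          have h2 : μ j ^ 2 * (1 / 4) ^ j = 4 * lam ^ 2 := by
            have : (2 ^ (j + 1) : ℝ) ^ 2 * (1 / 4) ^ j = 4 := by
              rw [← pow_mul, mul_comm (j + 1) 2, pow_mul, pow_succ]
              norm_num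
              rw [mul_assoc, mul_comm (4 : ℝ), ← mul_assoc, ← mul_pow]
              norm_num
            simp only [μ]
            linear_combination lam ^ 2 * this
          calc μ j ^ 2 * #(symmDiff t (π j t)) / 2
              ≤ μ j ^ 2 * ((1 / 4) ^ j * #I) / 2 := by gcongr
            _ = 2 * lam ^ 2 * #I := by rw [← mul_assoc, h2]; ring
      _ = _ := by
          rw [sum_const, nsmul_eq_mul]
          simp only [L]
          rw [Real.exp_add, Real.exp_add, Real.exp_log hNpos, Real.exp_log (by norm_num)]
          ring
  let Λ : ℝ := ∑ j ∈ range J, (1 / 2 : ℝ) ^ (j + 1) * L j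
  have hΛ : Λ ≤ 11 * d + 2 * lam ^ 2 * #I := by
    have hlog2 := Real.log_two_lt_d9
    have hlog2' := Real.log_two_gt_d9
    have hd1' : (1 : ℝ) ≤ d := by exact_mod_cast hd1
    have hL : ∀ j, L j ≤ (Real.log 2 + 2 * lam ^ 2 * #I) +
        2 * d * Real.log 2 * (2 * (j + 1) + 3) := by
      intro j
      have h1 := hNlog j
      have h2 : Real.log (8 * 4 ^ (j + 1)) = (2 * (j + 1) + 3) * Real.log 2 := by
        rw [show (8 : ℝ) * 4 ^ (j + 1) = 2 ^ (2 * (j + 1) + 3) by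
          rw [pow_add (2 : ℝ), pow_mul]; norm_num; ring, Real.log_pow]
        push_cast; ring
      rw [h2] at h1
      simp only [L]
      linarith
    calc Λ ≤ ∑ j ∈ range J, (1 / 2 : ℝ) ^ (j + 1) * ((Real.log 2 + 2 * lam ^ 2 * #I) +
          2 * d * Real.log 2 * (2 * (j + 1) + 3)) := by
          refine sum_le_sum fun j _ => ?_
          gcongr
          exact hL j
      _ = (∑ j ∈ range J, (1 / 2 : ℝ) ^ (j + 1)) * (Real.log 2 + 2 * lam ^ 2 * #I) +
          2 * d * Real.log 2 * ∑ j ∈ range J, (1 / 2 : ℝ) ^ (j + 1) * (2 * (j + 1) + 3) := by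
          rw [sum_mul, mul_sum, ← sum_add_distrib]
          exact sum_congr rfl fun j _ => by ring
      _ ≤ 1 * (Real.log 2 + 2 * lam ^ 2 * #I) + 2 * d * Real.log 2 * 7 := by
          gcongr
          · rw [sum_weight]
            linarith [show (0 : ℝ) < (1 / 2) ^ J by positivity]
          · exact sum_weight_mul_le J
      _ ≤ _ := by nlinarith
  refine ⟨fun ε => Real.exp Λ * ((1 / 2) ^ J +
    ∑ j ∈ range J, (1 / 2 : ℝ) ^ (j + 1) * (G j ε * Real.exp (-L j))), fun ε t ht => ?_, ?_⟩
  · have h1 := exp_weighted_sum_le J fun j => Real.log (G j ε) - L j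
    have h2 : ∑ j ∈ range J, (1 / 2 : ℝ) ^ (j + 1) * (Real.log (G j ε) - L j) =
        ∑ j ∈ range J, (1 / 2 : ℝ) ^ (j + 1) * Real.log (G j ε) - Λ := by
      simp only [Λ]
      rw [← sum_sub_distrib]
      exact sum_congr rfl fun j _ => by ring
    rw [h2] at h1
    have h3 : ∀ j, Real.exp (Real.log (G j ε) - L j) = G j ε * Real.exp (-L j) := fun j => by
      rw [sub_eq_add_neg, Real.exp_add, Real.exp_log (hGpos j ε)]
    simp_rw [h3] at h1
    calc Real.exp (lam * |signSum ε t|)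
        ≤ Real.exp (Λ + (∑ j ∈ range J, (1 / 2 : ℝ) ^ (j + 1) * Real.log (G j ε) - Λ)) := by
          rw [add_sub_cancel]
          exact Real.exp_le_exp.2 (hchain ε J t (hJ ht))
      _ ≤ _ := by
          rw [Real.exp_add]
          exact mul_le_mul_of_nonneg_left h1 (Real.exp_pos Λ).le
  · rw [← mul_sum, sum_add_distrib, sum_comm]
    have h1 : ∀ j, ∑ ε, (1 / 2 : ℝ) ^ (j + 1) * (G j ε * Real.exp (-L j)) ≤
        (1 / 2 : ℝ) ^ (j + 1) * 2 ^ Fintype.card ι := by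
      intro j
      rw [← mul_sum, ← sum_mul]
      gcongr
      calc (∑ ε, G j ε) * Real.exp (-L j)
          ≤ 2 ^ Fintype.card ι * Real.exp (L j) * Real.exp (-L j) := by gcongr; exact hGsum j
        _ = _ := by rw [mul_assoc, ← Real.exp_add]; simp
    have h2 : ∑ j ∈ range J, ∑ ε, (1 / 2 : ℝ) ^ (j + 1) * (G j ε * Real.exp (-L j)) ≤
        (1 - (1 / 2) ^ J) * 2 ^ Fintype.card ι := by
      rw [← sum_weight, sum_mul]
      exact sum_le_sum fun j _ => h1 j
    have h3 : ∑ _ε : ι → Bool, (1 / 2 : ℝ) ^ J = (1 / 2) ^ J * 2 ^ Fintype.card ι := by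
      simp [mul_comm]
    rw [h3, mul_comm]
    calc _ ≤ (2 : ℝ) ^ Fintype.card ι * Real.exp Λ := by
          gcongr
          linarith
      _ ≤ _ := by gcongr

/-! ### Exponential symmetrization -/

lemma norm_sum_sgn_smul_le {Z ι E : Type*} [Fintype ι] [NormedAddCommGroup E] [NormedSpace ℝ E]
    {b : ℝ} {F : Z → E} (hb : ∀ z, ‖F z‖ ≤ b) (ε : ι → Bool) (z : ι → Z) :
    ‖∑ i, sgn (ε i) • F (z i)‖ ≤ Fintype.card ι * b := by
  calc ‖∑ i, sgn (ε i) • F (z i)‖ ≤ ∑ _i : ι, b := norm_sum_le_of_le _ fun i _ => by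
        rw [norm_smul]
        have : ‖sgn (ε i)‖ = 1 := by rcases ε i <;> simp [sgn]
        rw [this, one_mul]
        exact hb _
    _ = _ := by simp

/-- Exponential symmetrization: for a bounded centred vector-valued `F`, the exponential moments of
`‖∑ F(zᵢ)‖` are bounded by those of the Rademacher averages `‖∑ εᵢ F(zᵢ)‖`, with twice the
parameter. An independent copy of the sample is subtracted (Jensen), and swapping the two copies at
any set of indices does not change the law of the pair. -/
theorem integral_exp_norm_sum_le_symmetrized {Z : Type*} [MeasurableSpace Z] {ι : Type*}
    [Fintype ι] [DecidableEq ι] {E : Type*} [NormedAddCommGroup E] [NormedSpace ℝ E]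
    [CompleteSpace E] [MeasurableSpace E] [BorelSpace E] [SecondCountableTopology E]
    (P : Measure Z) [IsProbabilityMeasure P] {F : Z → E}
    (hF : Measurable F) {b : ℝ} (hb : ∀ z, ‖F z‖ ≤ b) (hmean : ∫ z, F z ∂P = 0) {lam : ℝ}
    (hlam : 0 ≤ lam) :
    2 ^ Fintype.card ι * ∫ z, Real.exp (lam * ‖∑ i, F (z i)‖) ∂(Measure.pi fun _ : ι => P) ≤
      ∫ z, ∑ ε : ι → Bool, Real.exp (2 * lam * ‖∑ i, sgn (ε i) • F (z i)‖)
        ∂(Measure.pi fun _ : ι => P) := by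
  set ν := Measure.pi fun _ : ι => P with hν
  let H : (ι → Bool) → (ι → Z) × (ι → Z) → ℝ := fun ε q =>
    Real.exp (lam * ‖∑ i, sgn (ε i) • (F (q.1 i) - F (q.2 i))‖)
  let B : ℝ := Fintype.card ι * b
  have hbound : ∀ (ε : ι → Bool) (z z' : ι → Z),
      ‖∑ i, sgn (ε i) • (F (z i) - F (z' i))‖ ≤ B + B := by
    intro ε z z'
    simp_rw [smul_sub, Finset.sum_sub_distrib]
    exact (norm_sub_le _ _).trans
      (add_le_add (norm_sum_sgn_smul_le hb ε z) (norm_sum_sgn_smul_le hb ε z'))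
  have hHmeas : ∀ ε, Measurable (H ε) := fun ε => by
    simp only [H]
    fun_prop
  have hHint : ∀ ε, Integrable (H ε) (ν.prod ν) := fun ε =>
    Integrable.of_bound (hHmeas ε).aestronglyMeasurable (Real.exp (lam * (B + B)))
      (Filter.Eventually.of_forall fun q => by
        simp only [H, Real.norm_eq_abs, Real.abs_exp]
        gcongr
        exact hbound ε q.1 q.2)
  have hWint : ∀ (ε : ι → Bool) (μ : ℝ), 0 ≤ μ →
      Integrable (fun z : ι → Z => Real.exp (μ * ‖∑ i, sgn (ε i) • F (z i)‖)) ν := fun ε μ hμ =>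
    Integrable.of_bound (Measurable.aestronglyMeasurable (by fun_prop)) (Real.exp (μ * B))
      (Filter.Eventually.of_forall fun z => by
        simp only [Real.norm_eq_abs, Real.abs_exp]
        gcongr
        exact norm_sum_sgn_smul_le hb ε z)
  -- all signs equal to one
  let ε₁ : ι → Bool := fun _ => true
  have hε₁ : ∀ z : ι → Z, ∑ i, sgn (ε₁ i) • F (z i) = ∑ i, F (z i) := fun z => by
    simp [ε₁, sgn]
  have hFint : Integrable F P :=
    Integrable.of_bound hF.aestronglyMeasurable b (Filter.Eventually.of_forall hb)
  have hFi : ∀ i : ι, Integrable (fun z : ι → Z => F (z i)) ν := fun i =>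
    (measurePreserving_eval (fun _ : ι => P) i).integrable_comp_of_integrable hFint
  have hsum0 : ∫ z, ∑ i, F (z i) ∂ν = 0 := by
    rw [integral_finsetSum _ fun i _ => hFi i]
    refine Finset.sum_eq_zero fun i _ => ?_
    rw [← hmean]
    have h := (measurePreserving_eval (fun _ : ι => P) i).map_eq
    rw [← h, integral_map (measurable_pi_apply i).aemeasurable
      (by rw [h]; exact hF.aestronglyMeasurable)]
  have step1 : ∀ z : ι → Z, Real.exp (lam * ‖∑ i, F (z i)‖) ≤ ∫ z', H ε₁ (z, z') ∂ν := by
    intro z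
    have h1 : ∑ i, F (z i) = ∫ z', ∑ i, sgn (ε₁ i) • (F (z i) - F (z' i)) ∂ν := by
      have : ∀ z' : ι → Z, ∑ i, sgn (ε₁ i) • (F (z i) - F (z' i)) =
          ∑ i, F (z i) - ∑ i, F (z' i) := fun z' => by simp [ε₁, sgn]
      simp_rw [this]
      rw [integral_sub (integrable_const _) (integrable_finsetSum _ fun i _ => hFi i), hsum0]
      simp
    have hnint : Integrable
        (fun z' : ι → Z => lam * ‖∑ i, sgn (ε₁ i) • (F (z i) - F (z' i))‖) ν :=
      (Integrable.of_bound (Measurable.aestronglyMeasurable (by fun_prop)) (B + B)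
        (Filter.Eventually.of_forall fun z' => by
          rw [norm_norm]; exact hbound ε₁ z z')).const_mul lam
    have hsec : Integrable (fun z' => H ε₁ (z, z')) ν :=
      Integrable.of_bound ((hHmeas ε₁).comp measurable_prodMk_left).aestronglyMeasurable
        (Real.exp (lam * (B + B)))
        (Filter.Eventually.of_forall fun z' => by
          simp only [H, Real.norm_eq_abs, Real.abs_exp]
          gcongr
          exact hbound ε₁ z z')
    calc Real.exp (lam * ‖∑ i, F (z i)‖)
        ≤ Real.exp (∫ z', lam * ‖∑ i, sgn (ε₁ i) • (F (z i) - F (z' i))‖ ∂ν) := by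
          rw [integral_const_mul]
          gcongr
          rw [h1]
          exact norm_integral_le_integral_norm _
      _ ≤ ∫ z', H ε₁ (z, z') ∂ν :=
          convexOn_exp.map_integral_le Real.continuous_exp.continuousOn isClosed_univ
            (Filter.Eventually.of_forall fun _ => Set.mem_univ _) hnint hsec
  have step2 : ∀ ε, ∫ q, H ε₁ q ∂(ν.prod ν) = ∫ q, H ε q ∂(ν.prod ν) := by
    intro ε
    have hmp := measurePreserving_arrowProdEquivProdArrow Z Z ι (fun _ => P) (fun _ => P)
    have hsw : MeasurePreserving
        (fun (w : ι → Z × Z) i => (if ε i then id else Prod.swap : Z × Z → Z × Z) (w i))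
        (.pi fun _ => P.prod P) (.pi fun _ => P.prod P) :=
      measurePreserving_pi _ _ fun i => by
        rcases ε i
        · simpa using Measure.measurePreserving_swap
        · simpa using MeasurePreserving.id _
    rw [← hmp.map_eq,
      integral_map hmp.measurable.aemeasurable (hHmeas ε₁).aestronglyMeasurable,
      integral_map hmp.measurable.aemeasurable (hHmeas ε).aestronglyMeasurable]
    conv_lhs => rw [← hsw.map_eq]
    rw [integral_map (f := fun w => H ε₁ (MeasurableEquiv.arrowProdEquivProdArrow Z Z ι w))
      hsw.measurable.aemeasurable ((hHmeas ε₁).comp hmp.measurable).aestronglyMeasurable]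
    refine integral_congr_ae (Filter.Eventually.of_forall fun w => ?_)
    simp only [H, MeasurableEquiv.arrowProdEquivProdArrow, Equiv.arrowProdEquivProdArrow,
      MeasurableEquiv.coe_mk, Equiv.coe_fn_mk]
    congr 3
    refine Finset.sum_congr rfl fun i _ => ?_
    rcases ε i <;> simp [sgn, ε₁]
  have step3 : ∀ ε, ∫ q, H ε q ∂(ν.prod ν) ≤
      ∫ z, Real.exp (2 * lam * ‖∑ i, sgn (ε i) • F (z i)‖) ∂ν := by
    intro ε
    have hW := hWint ε (2 * lam) (by positivity)
    have h1 := hW.comp_fst ν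
    have h2 := hW.comp_snd ν
    calc ∫ q, H ε q ∂(ν.prod ν)
        ≤ ∫ q : (ι → Z) × (ι → Z), ((Real.exp (2 * lam * ‖∑ i, sgn (ε i) • F (q.1 i)‖) +
          Real.exp (2 * lam * ‖∑ i, sgn (ε i) • F (q.2 i)‖)) / 2) ∂(ν.prod ν) := by
          refine integral_mono (hHint ε) ((h1.add h2).div_const 2) fun q => ?_
          have h3 : ‖∑ i, sgn (ε i) • (F (q.1 i) - F (q.2 i))‖ ≤
              ‖∑ i, sgn (ε i) • F (q.1 i)‖ + ‖∑ i, sgn (ε i) • F (q.2 i)‖ := by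
            simp_rw [smul_sub, Finset.sum_sub_distrib]
            exact norm_sub_le _ _
          set u := ‖∑ i, sgn (ε i) • F (q.1 i)‖
          set v := ‖∑ i, sgn (ε i) • F (q.2 i)‖
          have h4 : H ε q ≤ Real.exp (lam * u) * Real.exp (lam * v) := by
            rw [← Real.exp_add, ← mul_add]
            simp only [H]
            gcongr
          have h5 : Real.exp (2 * lam * u) = Real.exp (lam * u) ^ 2 := by
            rw [← Real.exp_nat_mul]; push_cast; ring_nf
          have h6 : Real.exp (2 * lam * v) = Real.exp (lam * v) ^ 2 := by
            rw [← Real.exp_nat_mul]; push_cast; ring_nf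
          show H ε q ≤ (Real.exp (2 * lam * u) + Real.exp (2 * lam * v)) / 2
          rw [h5, h6]
          nlinarith [sq_nonneg (Real.exp (lam * u) - Real.exp (lam * v))]
      _ = _ := by
          rw [integral_div, integral_add h1 h2,
            integral_fun_fst (μ := ν) (ν := ν)
              (fun z : ι → Z => Real.exp (2 * lam * ‖∑ i, sgn (ε i) • F (z i)‖)),
            integral_fun_snd (μ := ν) (ν := ν)
              (fun z : ι → Z => Real.exp (2 * lam * ‖∑ i, sgn (ε i) • F (z i)‖))]
          simp
  have hmain : ∀ ε : ι → Bool, ∫ z, Real.exp (lam * ‖∑ i, F (z i)‖) ∂ν ≤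
      ∫ z, Real.exp (2 * lam * ‖∑ i, sgn (ε i) • F (z i)‖) ∂ν := by
    intro ε
    calc ∫ z, Real.exp (lam * ‖∑ i, F (z i)‖) ∂ν ≤ ∫ z, ∫ z', H ε₁ (z, z') ∂ν ∂ν := by
          refine integral_mono ?_ (hHint ε₁).integral_prod_left step1
          have := hWint ε₁ lam hlam
          simpa only [hε₁] using this
      _ = ∫ q, H ε₁ q ∂(ν.prod ν) := (integral_prod _ (hHint ε₁)).symm
      _ = ∫ q, H ε q ∂(ν.prod ν) := step2 ε
      _ ≤ _ := step3 ε
  rw [integral_finsetSum Finset.univ fun (ε : ι → Bool) _ => hWint ε (2 * lam) (by positivity)]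
  calc _ = ∑ _ε : ι → Bool, ∫ z, Real.exp (lam * ‖∑ i, F (z i)‖) ∂ν := by simp
    _ ≤ _ := Finset.sum_le_sum fun ε _ => hmain ε

/-! ### The number of sample points in a set -/

section Binomial

variable {Z : Type*} {ι : Type*} [Fintype ι]

open Classical in
/-- The indices of the points of a sample that lie in the set `τ`. -/
def hits (τ : Set Z) (z : ι → Z) : Finset ι := Finset.univ.filter fun i => z i ∈ τ

lemma card_hits (τ : Set Z) (z : ι → Z) :
    ((hits τ z).card : ℝ) = ∑ i, τ.indicator (fun _ => (1 : ℝ)) (z i) := by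
  classical
  simp [hits, Set.indicator_apply]

variable [MeasurableSpace Z]

lemma measurable_card_hits {τ : Set Z} (hτ : MeasurableSet τ) :
    Measurable fun z : ι → Z => ((hits τ z).card : ℝ) := by
  simp_rw [card_hits]
  exact Finset.measurable_fun_sum _ fun i _ =>
    (measurable_const.indicator hτ).comp (measurable_pi_apply i)

lemma integrable_exp_card_hits (P : Measure Z) [IsProbabilityMeasure P] {τ : Set Z}
    (hτ : MeasurableSet τ) (c : ℝ) :
    Integrable (fun z : ι → Z => Real.exp (c * (hits τ z).card)) (Measure.pi fun _ : ι => P) := by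
  refine Integrable.of_bound
    (Real.measurable_exp.comp ((measurable_card_hits hτ).const_mul c)).aestronglyMeasurable
    (Real.exp (|c| * Fintype.card ι)) (Filter.Eventually.of_forall fun z => ?_)
  simp only [Real.norm_eq_abs, Real.abs_exp]
  gcongr
  · exact le_abs_self c
  · exact Finset.card_le_univ _

/-- The moment generating function of a binomial variable is at most that of the Poisson variable
with the same mean. -/
lemma integral_exp_card_hits_le (P : Measure Z) [IsProbabilityMeasure P] {τ : Set Z}
    (hτ : MeasurableSet τ) (c : ℝ) :
    ∫ z, Real.exp (c * (hits τ z).card) ∂(Measure.pi fun _ : ι => P) ≤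
      Real.exp (Fintype.card ι * P.real τ * (Real.exp c - 1)) := by
  have h1 : ∀ z : ι → Z, Real.exp (c * (hits τ z).card) =
      ∏ i, (1 + τ.indicator (fun _ => Real.exp c - 1) (z i)) := by
    intro z
    rw [card_hits, Finset.mul_sum, Real.exp_sum]
    refine Finset.prod_congr rfl fun i _ => ?_
    by_cases h : z i ∈ τ <;> simp [h]
  simp_rw [h1]
  rw [integral_fintype_prod_eq_pow (fun z => 1 + τ.indicator (fun _ => Real.exp c - 1) z),
    integral_add (integrable_const _) ((integrable_const _).indicator hτ),
    integral_indicator_const _ hτ]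
  have h2 : (Fintype.card ι : ℝ) * P.real τ * (Real.exp c - 1) =
      Fintype.card ι * (P.real τ * (Real.exp c - 1)) := by ring
  rw [h2, Real.exp_nat_mul]
  simp only [integral_const, probReal_univ, smul_eq_mul, mul_one]
  refine pow_le_pow_left₀ ?_ ?_ _
  · have h3 : P.real τ ≤ 1 := measureReal_le_one
    have h4 : 0 ≤ P.real τ := measureReal_nonneg
    nlinarith [Real.exp_pos c]
  · linarith [Real.add_one_le_exp (P.real τ * (Real.exp c - 1))]

/-- The lower Chernoff bound at half the mean. -/
lemma measureReal_card_hits_lt_le (P : Measure Z) [IsProbabilityMeasure P] {τ : Set Z}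
    (hτ : MeasurableSet τ) :
    (Measure.pi fun _ : ι => P).real
        {z | ((hits τ z).card : ℝ) < Fintype.card ι * P.real τ / 2} ≤
      Real.exp (-(Fintype.card ι * P.real τ / 8)) := by
  set q : ℝ := Fintype.card ι * P.real τ with hq
  have hq0 : 0 ≤ q := by positivity
  set c := -Real.log 2 with hc
  have hmk := mul_meas_ge_le_integral_of_nonneg (μ := Measure.pi fun _ : ι => P)
    (Filter.Eventually.of_forall fun z : ι → Z => (Real.exp_pos (c * (hits τ z).card)).le)
    (integrable_exp_card_hits P hτ c) (Real.exp (c * (q / 2)))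
  have hsub : {z : ι → Z | ((hits τ z).card : ℝ) < q / 2} ⊆
      {z | Real.exp (c * (q / 2)) ≤ Real.exp (c * (hits τ z).card)} := by
    intro z hz
    refine Real.exp_le_exp.2 ?_
    have h0 : c ≤ 0 := by
      have := Real.log_two_gt_d9
      linarith
    exact mul_le_mul_of_nonpos_left (le_of_lt hz) h0
  have h1 := measureReal_mono (μ := Measure.pi fun _ : ι => P) hsub
  have h2 := hmk.trans (integral_exp_card_hits_le P hτ c)
  have hec : Real.exp c = 1 / 2 := by
    rw [hc, Real.exp_neg, Real.exp_log (by norm_num)]; norm_num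
  rw [hec, ← hq] at h2
  refine h1.trans ?_
  rw [mul_comm, ← le_div_iff₀ (Real.exp_pos _), ← Real.exp_sub] at h2
  refine h2.trans (Real.exp_le_exp.2 ?_)
  have := Real.log_two_lt_d9
  rw [hc]
  nlinarith

end Binomial

/-! ### Uniform deviations within a group -/

section VC

variable {Z : Type*} {ι : Type*} [Fintype ι]

/-- The family of the traces that the sets `τ ∩ G j` leave on every sample has VC dimension at most
`d`. -/
def TracesVCDimLE (ι : Type*) [Fintype ι] {Θ : Type*} (τ : Set Z) (G : Θ → Set Z) (d : ℕ) :
    Prop :=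
  ∀ (z : ι → Z) (B : Finset ι),
    (∀ s ⊆ B, ∃ j, ∀ i ∈ B, i ∈ s ↔ z i ∈ τ ∩ G j) → B.card ≤ d

/-- The centred indicators of the sets `τ ∩ G j`, the centring being done within `τ`: the sum over
a sample is the number of hits of `τ ∩ G j` minus its expectation given the number of hits
of `τ`. -/
def centred [MeasurableSpace Z] {Θ : Type*} (P : Measure Z) (τ : Set Z) (G : Θ → Set Z) (z : Z)
    (j : Θ) : ℝ :=
  (τ ∩ G j).indicator (fun _ => (1 : ℝ)) z -
    P.real (τ ∩ G j) / P.real τ * τ.indicator (fun _ => (1 : ℝ)) z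

lemma signSum_hits (ε : ι → Bool) (τ : Set Z) (z : ι → Z) :
    signSum ε (hits τ z) = ∑ i, sgn (ε i) * τ.indicator (fun _ => (1 : ℝ)) (z i) := by
  classical
  rw [signSum, hits, Finset.sum_filter]
  exact Finset.sum_congr rfl fun i _ => by by_cases h : z i ∈ τ <;> simp [h]

lemma exists_norm_apply_eq {Θ : Type*} [Fintype Θ] [Nonempty Θ] (v : Θ → ℝ) :
    ∃ j, ‖v‖ = |v j| := by
  obtain ⟨j, -, hj⟩ := Finset.exists_mem_eq_sup Finset.univ Finset.univ_nonempty fun j => ‖v j‖₊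
  refine ⟨j, ?_⟩
  rw [Pi.norm_def, hj]
  simp

variable [MeasurableSpace Z]

lemma ratio_nonneg (P : Measure Z) (τ G : Set Z) : 0 ≤ P.real (τ ∩ G) / P.real τ := by positivity

lemma ratio_le_one (P : Measure Z) [IsFiniteMeasure P] (τ G : Set Z) :
    P.real (τ ∩ G) / P.real τ ≤ 1 :=
  div_le_one_of_le₀ (measureReal_mono Set.inter_subset_left) measureReal_nonneg

lemma abs_centred_le_one {Θ : Type*} (P : Measure Z) [IsFiniteMeasure P] (τ : Set Z)
    (G : Θ → Set Z) (z : Z) (j : Θ) : |centred P τ G z j| ≤ 1 := by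
  have h0 := ratio_nonneg P τ (G j)
  have h1 := ratio_le_one P τ (G j)
  rw [centred, abs_le]
  by_cases h : z ∈ τ <;> by_cases h' : z ∈ G j <;> simp [h, h'] <;> constructor <;> linarith

lemma norm_centred_le_one {Θ : Type*} [Fintype Θ] (P : Measure Z) [IsFiniteMeasure P] (τ : Set Z)
    (G : Θ → Set Z) (z : Z) : ‖centred P τ G z‖ ≤ 1 :=
  (pi_norm_le_iff_of_nonneg zero_le_one).2 fun j => abs_centred_le_one P τ G z j

lemma measurable_centred {Θ : Type*} (P : Measure Z) {τ : Set Z} (hτ : MeasurableSet τ)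
    {G : Θ → Set Z} (hG : ∀ j, MeasurableSet (G j)) : Measurable (centred P τ G) :=
  measurable_pi_iff.2 fun j => (measurable_const.indicator (hτ.inter (hG j))).sub
    ((measurable_const.indicator hτ).const_mul _)

/-- The exponential moments of the uniform deviation within `τ` over a finite class: after
symmetrization only the points of the sample in `τ` matter, chaining handles them, and the number of
these points has Poissonian exponential moments. -/
theorem integral_exp_norm_centred_le {Θ : Type*} [Fintype Θ] [Nonempty Θ] (P : Measure Z)
    [IsProbabilityMeasure P] {τ : Set Z} (hτ : MeasurableSet τ) (hp : 0 < P.real τ)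
    {G : Θ → Set Z} (hG : ∀ j, MeasurableSet (G j)) {d : ℕ} (hd1 : 1 ≤ d)
    (hd : TracesVCDimLE ι τ G d) {lam : ℝ} (hlam : 0 ≤ lam) (hlam1 : 32 * lam ^ 2 ≤ 1) :
    ∫ z, Real.exp (lam * ‖∑ i, centred P τ G (z i)‖) ∂(Measure.pi fun _ : ι => P) ≤
      Real.exp (11 * d + 64 * lam ^ 2 * (Fintype.card ι * P.real τ)) := by
  classical
  set ν := Measure.pi fun _ : ι => P
  have hmeas := measurable_centred P hτ hG
  have hb := norm_centred_le_one P τ G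
  have hmean : ∫ z, centred P τ G z ∂P = 0 := by
    funext j
    have hint : ∀ j, Integrable (fun z => centred P τ G z j) P := fun j => Integrable.of_bound
      ((measurable_pi_apply j).comp hmeas).aestronglyMeasurable 1
      (Filter.Eventually.of_forall fun z => abs_centred_le_one P τ G z j)
    rw [eval_integral hint]
    simp only [centred]
    rw [integral_sub ((integrable_const _).indicator (hτ.inter (hG j)))
      (((integrable_const _).indicator hτ).const_mul _), integral_const_mul,
      integral_indicator_const _ hτ, integral_indicator_const _ (hτ.inter (hG j))]
    simp only [smul_eq_mul, mul_one, Pi.zero_apply]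
    rw [div_mul_cancel₀ _ hp.ne', sub_self]
  have hsym := integral_exp_norm_sum_le_symmetrized (ι := ι) P hmeas hb hmean hlam
  have hcond : ∀ z : ι → Z, ∑ ε : ι → Bool,
      Real.exp (2 * lam * ‖∑ i, sgn (ε i) • centred P τ G (z i)‖) ≤
      2 ^ Fintype.card ι * (Real.exp (11 * d) * Real.exp (32 * lam ^ 2 * (hits τ z).card)) := by
    intro z
    let T : Finset (Finset ι) := Finset.univ.image fun j => hits (τ ∩ G j) z
    have hTI : ∀ t ∈ T, t ⊆ hits τ z := by
      intro t ht
      obtain ⟨j, -, rfl⟩ := Finset.mem_image.1 ht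
      intro i hi
      simp only [hits, Finset.mem_filter, Finset.mem_univ, true_and] at hi ⊢
      exact hi.1
    have hTd : ∀ B, T.Shatters B → B.card ≤ d := by
      intro B hB
      refine hd z B fun s hs => ?_
      obtain ⟨u, hu, hus⟩ := hB hs
      obtain ⟨j, -, rfl⟩ := Finset.mem_image.1 hu
      refine ⟨j, fun i hi => ?_⟩
      rw [← hus]
      simp [hits, hi]
    obtain ⟨R, hR, hRsum⟩ := rademacher_chaining (T := T) (Finset.univ_nonempty.image _) hTI hd1
      hTd (show 0 ≤ 4 * lam by positivity)
    -- the one-element family `{hits τ z}` controls the centring terms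
    obtain ⟨R', hR', hRsum'⟩ := rademacher_chaining (T := {hits τ z})
      (Finset.singleton_nonempty _) (I := hits τ z) (by simp) hd1
      (fun B hB => by
        have : B.card = 0 := by
          by_contra h0
          obtain ⟨i, hi⟩ := Finset.card_pos.1 (Nat.pos_of_ne_zero h0)
          obtain ⟨u, hu, hui⟩ := hB (t := B) subset_rfl
          obtain ⟨u', hu', hui'⟩ := hB (t := ∅) (Finset.empty_subset _)
          rw [Finset.mem_singleton] at hu hu'
          rw [hu] at hui
          rw [hu', hui] at hui'
          simp [hui'] at hi
        omega)
      (show 0 ≤ 4 * lam by positivity)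
    have hpt : ∀ ε : ι → Bool, Real.exp (2 * lam * ‖∑ i, sgn (ε i) • centred P τ G (z i)‖) ≤
        (R ε + R' ε) / 2 := by
      intro ε
      obtain ⟨j, hj⟩ := exists_norm_apply_eq (∑ i, sgn (ε i) • centred P τ G (z i))
      set u := |signSum ε (hits (τ ∩ G j) z)| with hu
      set v := |signSum ε (hits τ z)| with hv
      have h1 : ‖∑ i, sgn (ε i) • centred P τ G (z i)‖ ≤ u + v := by
        rw [hj]
        have : (∑ i, sgn (ε i) • centred P τ G (z i)) j = signSum ε (hits (τ ∩ G j) z) -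
            P.real (τ ∩ G j) / P.real τ * signSum ε (hits τ z) := by
          rw [signSum_hits, signSum_hits, Finset.mul_sum, ← Finset.sum_sub_distrib,
            Finset.sum_apply]
          refine Finset.sum_congr rfl fun i _ => ?_
          simp only [Pi.smul_apply, centred, smul_eq_mul]
          ring
        rw [this]
        refine (abs_sub _ _).trans ?_
        gcongr
        rw [abs_mul, abs_of_nonneg (ratio_nonneg P τ (G j))]
        exact mul_le_of_le_one_left (abs_nonneg _) (ratio_le_one P τ (G j))
      have h2 := hR ε (hits (τ ∩ G j) z) (Finset.mem_image_of_mem _ (Finset.mem_univ j))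
      have h3 := hR' ε (hits τ z) (Finset.mem_singleton_self _)
      have h5 : Real.exp (4 * lam * u) = Real.exp (2 * lam * u) ^ 2 := by
        rw [← Real.exp_nat_mul]; push_cast; ring_nf
      have h6 : Real.exp (4 * lam * v) = Real.exp (2 * lam * v) ^ 2 := by
        rw [← Real.exp_nat_mul]; push_cast; ring_nf
      have h4 : Real.exp (2 * lam * ‖∑ i, sgn (ε i) • centred P τ G (z i)‖) ≤
          Real.exp (2 * lam * u) * Real.exp (2 * lam * v) := by
        rw [← Real.exp_add, ← mul_add]
        gcongr
      nlinarith [sq_nonneg (Real.exp (2 * lam * u) - Real.exp (2 * lam * v))]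
    have h16 : 2 * (4 * lam) ^ 2 * ((hits τ z).card : ℝ) = 32 * lam ^ 2 * (hits τ z).card := by
      ring
    rw [h16] at hRsum hRsum'
    rw [← Real.exp_add]
    calc _ ≤ ∑ ε, (R ε + R' ε) / 2 := Finset.sum_le_sum fun ε _ => hpt ε
      _ = (∑ ε, R ε + ∑ ε, R' ε) / 2 := by rw [← Finset.sum_div, Finset.sum_add_distrib]
      _ ≤ _ := by linarith
  have h1 : 2 ^ Fintype.card ι * ∫ z, Real.exp (lam * ‖∑ i, centred P τ G (z i)‖) ∂ν ≤
      2 ^ Fintype.card ι * (Real.exp (11 * d) *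
        Real.exp (Fintype.card ι * P.real τ * (Real.exp (32 * lam ^ 2) - 1))) := by
    refine hsym.trans ?_
    calc _ ≤ ∫ z, 2 ^ Fintype.card ι * (Real.exp (11 * d) *
          Real.exp (32 * lam ^ 2 * (hits τ z).card)) ∂ν := by
          refine integral_mono_of_nonneg (Filter.Eventually.of_forall fun z => by positivity)
            (((integrable_exp_card_hits P hτ _).const_mul _).const_mul _)
            (Filter.Eventually.of_forall hcond)
      _ ≤ _ := by
          rw [integral_const_mul, integral_const_mul]
          gcongr
          exact integral_exp_card_hits_le P hτ _
  refine (le_of_mul_le_mul_left h1 (by positivity)).trans ?_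
  rw [← Real.exp_add]
  refine Real.exp_le_exp.2 (add_le_add_right ?_ _)
  have h2 : Real.exp (32 * lam ^ 2) - 1 ≤ 64 * lam ^ 2 := by
    have h3 := Real.abs_exp_sub_one_le (x := 32 * lam ^ 2)
      (by rw [abs_of_nonneg (by positivity)]; exact hlam1)
    rw [abs_of_nonneg (by positivity : 0 ≤ 32 * lam ^ 2)] at h3
    linarith [le_abs_self (Real.exp (32 * lam ^ 2) - 1)]
  calc (Fintype.card ι : ℝ) * P.real τ * (Real.exp (32 * lam ^ 2) - 1)
      ≤ Fintype.card ι * P.real τ * (64 * lam ^ 2) := by gcongr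
    _ = _ := by ring

/-- The uniform deviation within `τ` over a finite class, in probability. -/
lemma measureReal_exists_centred_finite_le {Θ : Type*} [Fintype Θ] [Nonempty Θ] (P : Measure Z)
    [IsProbabilityMeasure P] {τ : Set Z} (hτ : MeasurableSet τ) (hp : 0 < P.real τ)
    {G : Θ → Set Z} (hG : ∀ j, MeasurableSet (G j)) {d : ℕ} (hd1 : 1 ≤ d)
    (hd : TracesVCDimLE ι τ G d) {L : ℝ} (hL : (d : ℝ) ≤ L)
    (hL2 : L ≤ 2 * (Fintype.card ι * P.real τ)) :
    (Measure.pi fun _ : ι => P).real {z | ∃ j,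
      104 * √(L * (Fintype.card ι * P.real τ)) < |∑ i, centred P τ G (z i) j|} ≤
      Real.exp (-L) := by
  set q : ℝ := Fintype.card ι * P.real τ
  have hd1' : (1 : ℝ) ≤ d := by exact_mod_cast hd1
  have hL0 : 0 < L := by linarith
  have hq0 : 0 < q := by linarith
  -- this parameter makes `64 lam² q = L`
  set lam := √(L / (64 * q)) with hlam
  have hlam2 : lam ^ 2 = L / (64 * q) := Real.sq_sqrt (by positivity)
  have hlam0 : 0 ≤ lam := Real.sqrt_nonneg _
  have hmom := integral_exp_norm_centred_le (ι := ι) P hτ hp hG hd1 hd hlam0 (by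
    rw [hlam2, ← mul_div_assoc, div_le_one (by positivity)]; linarith)
  have h64 : 64 * lam ^ 2 * q = L := by rw [hlam2]; field_simp
  rw [h64] at hmom
  have hlu : lam * (104 * √(L * q)) = 13 * L := by
    have h1 : lam * √(L * q) = L / 8 := by
      rw [hlam, ← Real.sqrt_mul (by positivity),
        show L / (64 * q) * (L * q) = (L / 8) ^ 2 by field_simp; ring,
        Real.sqrt_sq (by positivity)]
    linear_combination 104 * h1
  have hmeas : Measurable fun z : ι → Z => Real.exp (lam * ‖∑ i, centred P τ G (z i)‖) := by
    have hmeas := measurable_centred P hτ hG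
    fun_prop
  have hb := norm_centred_le_one P τ G
  have hint : Integrable (fun z : ι → Z => Real.exp (lam * ‖∑ i, centred P τ G (z i)‖))
      (Measure.pi fun _ : ι => P) :=
    Integrable.of_bound hmeas.aestronglyMeasurable (Real.exp (lam * Fintype.card ι))
      (Filter.Eventually.of_forall fun z => by
        simp only [Real.norm_eq_abs, Real.abs_exp]
        gcongr
        refine (norm_sum_le_of_le _ fun i _ => hb (z i)).trans ?_
        simp)
  have hmk := mul_meas_ge_le_integral_of_nonneg (μ := Measure.pi fun _ : ι => P)
    (Filter.Eventually.of_forall fun z : ι → Z =>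
      (Real.exp_pos (lam * ‖∑ i, centred P τ G (z i)‖)).le) hint (Real.exp (13 * L))
  have hsub : {z : ι → Z | ∃ j, 104 * √(L * q) < |∑ i, centred P τ G (z i) j|} ⊆
      {z | Real.exp (13 * L) ≤ Real.exp (lam * ‖∑ i, centred P τ G (z i)‖)} := by
    rintro z ⟨j, hj⟩
    refine Real.exp_le_exp.2 ?_
    rw [← hlu]
    gcongr
    refine hj.le.trans ?_
    have := norm_le_pi_norm (∑ i, centred P τ G (z i)) j
    rwa [Finset.sum_apply] at this
  have h2 := hmk.trans hmom
  rw [mul_comm, ← le_div_iff₀ (Real.exp_pos _), ← Real.exp_sub] at h2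
  refine (measureReal_mono hsub).trans (h2.trans (Real.exp_le_exp.2 ?_))
  linarith

/-- The uniform deviation within `τ` over a countable class of VC dimension at most `d`: for
`d ≤ L`, the centred sums all stay below a multiple of `√(L n P(τ))`, with probability at least
`1 - exp (-L)`. -/
theorem measureReal_exists_centred_le (P : Measure Z)
    [IsProbabilityMeasure P] {τ : Set Z} (hτ : MeasurableSet τ) (hp : 0 < P.real τ)
    {G : ℕ → Set Z} (hG : ∀ j, MeasurableSet (G j)) {d : ℕ} (hd1 : 1 ≤ d)
    (hd : TracesVCDimLE ι τ G d) {L : ℝ} (hL : (d : ℝ) ≤ L)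
    (hL2 : L ≤ 2 * (Fintype.card ι * P.real τ)) :
    (Measure.pi fun _ : ι => P).real {z | ∃ j,
      104 * √(L * (Fintype.card ι * P.real τ)) < |∑ i, centred P τ G (z i) j|} ≤
      Real.exp (-L) := by
  set u := 104 * √(L * (Fintype.card ι * P.real τ))
  let S : ℕ → Set (ι → Z) := fun J => {z | ∃ j ≤ J, u < |∑ i, centred P τ G (z i) j|}
  have hS : {z : ι → Z | ∃ j, u < |∑ i, centred P τ G (z i) j|} = ⋃ J, S J := by
    ext z
    simp only [S, Set.mem_iUnion, Set.mem_ofPred_eq]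
    exact ⟨fun ⟨j, hj⟩ => ⟨j, j, le_rfl, hj⟩, fun ⟨_, j, _, hj⟩ => ⟨j, hj⟩⟩
  have hmono : Monotone S := fun J J' h z ⟨j, hj, hz⟩ => ⟨j, hj.trans h, hz⟩
  have hfin : ∀ J, (Measure.pi fun _ : ι => P).real (S J) ≤ Real.exp (-L) := by
    intro J
    have h := measureReal_exists_centred_finite_le (ι := ι) (Θ := Fin (J + 1)) P hτ hp
      (G := fun j => G j) (fun j => hG j) hd1
      (fun z B hB => hd z B fun s hs => by
        obtain ⟨j, hj⟩ := hB s hs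
        exact ⟨j, hj⟩) hL hL2
    refine (measureReal_mono ?_).trans h
    rintro z ⟨j, hj, hz⟩
    exact ⟨⟨j, by omega⟩, hz⟩
  rw [hS]
  have hlim := tendsto_measure_iUnion_atTop (μ := Measure.pi fun _ : ι => P) hmono
  have hlim' := (ENNReal.tendsto_toReal (measure_ne_top _ _)).comp hlim
  exact le_of_tendsto' hlim' hfin

lemma sum_centred {Θ : Type*} (P : Measure Z) (τ : Set Z) (G : Θ → Set Z) (z : ι → Z) (j : Θ) :
    ∑ i, centred P τ G (z i) j = (hits (τ ∩ G j) z).card -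
      P.real (τ ∩ G j) / P.real τ * (hits τ z).card := by
  rw [card_hits, card_hits, Finset.mul_sum, ← Finset.sum_sub_distrib]
  rfl

end VC

/-! ### Linear predictors and their Natarajan dimension -/

lemma linModel_eq_inner {m : ℕ} (θ x : Param m) : linModel θ x = inner ℝ x θ := by
  simp [linModel, PiLp.inner_apply]

lemma linModel_add_smul {m : ℕ} (θ ξ x : Param m) (σ : ℝ) :
    linModel (θ + σ • ξ) x = linModel θ x + σ * linModel ξ x := by
  simp only [linModel_eq_inner, inner_add_right, inner_smul_right]

lemma abs_linModel_le {m : ℕ} (θ x : Param m) : |linModel θ x| ≤ ‖θ‖ * ‖x‖ := by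
  rw [linModel_eq_inner, mul_comm]
  exact abs_real_inner_le_norm x θ

lemma linModel_single_last {m : ℕ} (x : Param m) :
    linModel (EuclideanSpace.single (Fin.last m) 1) x = x (Fin.last m) := by
  simp [linModel_eq_inner, EuclideanSpace.inner_single_right]

lemma measurable_linModel {m : ℕ} {α : Type*} [MeasurableSpace α] {f g : α → Param m}
    (hf : Measurable f) (hg : Measurable g) : Measurable fun a => linModel (f a) (g a) := by
  simp_rw [linModel_eq_inner]
  exact hg.inner hf

lemma units_int_eq_of_ne_of_ne {a b c : ℤˣ} (h : a ≠ b) (h' : c ≠ b) : a = c := by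
  rcases Int.units_eq_one_or a with rfl | rfl <;> rcases Int.units_eq_one_or b with rfl | rfl <;>
    rcases Int.units_eq_one_or c with rfl | rfl <;> simp_all

lemma predict_eq_iff {m : ℕ} (θ x : Param m) (y : ℤˣ) :
    predict θ x = y ↔ (0 ≤ linModel θ x ∧ y = 1) ∨ (linModel θ x < 0 ∧ y = -1) := by
  by_cases h : 0 ≤ linModel θ x
  · simp [predict, h, not_lt.2 h, eq_comm]
  · simp [predict, h, not_le.1 h, eq_comm]

lemma measurableSet_units_int (s : Set ℤˣ) : MeasurableSet s :=
  ⟨Units.val '' s, MeasurableSet.of_discrete, Set.preimage_image_eq _ Units.val_injective⟩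

lemma measurableSet_predict_eq {m : ℕ} {α : Type*} [MeasurableSpace α] {f g : α → Param m}
    {l : α → ℤˣ} (hf : Measurable f) (hg : Measurable g) (hl : Measurable l) :
    MeasurableSet {a | predict (f a) (g a) = l a} := by
  simp_rw [predict_eq_iff]
  have h1 := measurable_linModel hf hg
  exact ((measurableSet_le measurable_const h1).inter (hl (measurableSet_units_int {1}))).union
    ((measurableSet_lt h1 measurable_const).inter (hl (measurableSet_units_int {-1})))

/-- The data points that the model `h_θ` classifies correctly. -/
def correct {m : ℕ} {𝒳 : Set (Param m)} {S : Type*} (θ : Param m) : Set (Data 𝒳 S) :=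
  {z | predict θ z.1 = z.2.2}

section Data

variable {m : ℕ} {𝒳 : Set (Param m)} {S : Type*}

section

variable [MeasurableSpace S]

lemma measurableSet_correct (θ : Param m) : MeasurableSet (correct θ : Set (Data 𝒳 S)) :=
  measurableSet_predict_eq measurable_const (measurable_subtype_coe.comp measurable_fst)
    measurable_snd.snd

lemma accuracy_eq (θ : Param m) (Q : Measure (Data 𝒳 S)) : accuracy θ Q = Q.real (correct θ) := rfl

end

/-- A relation `∑ g_x x = 0` between more than `p` points is violated by a model that is
nonnegative exactly where `g` is positive, so at most `p` points can be shattered. -/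
lemma card_le_of_natarajanShatters {B : Finset 𝒳} (hB : NatarajanShatters (linClass 𝒳) B) :
    B.card ≤ m + 1 := by
  classical
  by_contra! hcard
  obtain ⟨f₀, f₁, hne, hsh⟩ := hB
  -- every labelling of `B` is realized by a model
  have hreal : ∀ l : 𝒳 → ℤˣ, ∃ θ : Param m, ∀ x ∈ B, predict θ x = l x := by
    intro l
    obtain ⟨h, ⟨θ, rfl⟩, hh⟩ := hsh (B.filter fun x => f₀ x = l x) (Finset.filter_subset _ _)
    refine ⟨θ, fun x hx => ?_⟩
    by_cases hl : f₀ x = l x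
    · rw [← hl]
      exact (hh x hx).1 (Finset.mem_filter.2 ⟨hx, hl⟩)
    · have h1 := (hh x hx).2 fun h => hl (Finset.mem_filter.1 h).2
      exact h1.trans (units_int_eq_of_ne_of_ne (hne x hx).symm (Ne.symm hl))
  obtain ⟨g, hg0, x₀, hx₀, hgx₀⟩ := Module.exists_nontrivial_relation_of_finrank_lt_card
    (R := ℝ) (t := B.map (Function.Embedding.subtype _)) (by
      rw [Finset.card_map, finrank_euclideanSpace_fin]; exact hcard)
  rw [Finset.sum_map] at hg0
  obtain ⟨x₁, hx₁, rfl⟩ := Finset.mem_map.1 hx₀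
  have key : ∀ g : Param m → ℝ, ∑ x ∈ B, g x • (x : Param m) = 0 → (∃ x ∈ B, g x < 0) → False := by
    rintro g hg ⟨x₂, hx₂, hneg⟩
    obtain ⟨θ, hθ⟩ := hreal fun x => if 0 < g x then 1 else -1
    have h1 : ∑ x ∈ B, g x * linModel θ x = 0 := by
      have := congrArg (fun v => inner ℝ v θ) hg
      simpa [sum_inner, inner_smul_left, linModel_eq_inner] using this
    have hpos : ∀ x ∈ B, 0 < g x → 0 ≤ linModel θ x := fun x hx h => by
      have := (predict_eq_iff θ x _).1 (hθ x hx)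
      simpa [h] using this
    have hnpos : ∀ x ∈ B, ¬ 0 < g x → linModel θ x < 0 := fun x hx h => by
      have := (predict_eq_iff θ x _).1 (hθ x hx)
      simpa [h] using this
    have h2 : 0 < ∑ x ∈ B, g x * linModel θ x := by
      refine Finset.sum_pos' (fun x hx => ?_)
        ⟨x₂, hx₂, mul_pos_of_neg_of_neg hneg (hnpos x₂ hx₂ hneg.not_gt)⟩
      by_cases h : 0 < g x
      · exact mul_nonneg h.le (hpos x hx h)
      · exact mul_nonneg_of_nonpos_of_nonpos (not_lt.1 h) (hnpos x hx h).le
    exact h2.ne' h1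
  rcases lt_or_gt_of_ne hgx₀ with h | h
  · exact key g hg0 ⟨x₁, hx₁, h⟩
  · exact key (fun x => -g x) (by
      have : ∑ x ∈ B, g x • (x : Param m) = 0 := hg0
      simp [Finset.sum_neg_distrib, this]) ⟨x₁, hx₁, by simpa using h⟩

lemma natarajanDim_linClass_ne_top (𝒳 : Set (Param m)) : natarajanDim (linClass 𝒳) ≠ ⊤ := by
  have h : natarajanDim (linClass 𝒳) ≤ ((m + 1 : ℕ) : ℕ∞) :=
    iSup_le fun B => by exact_mod_cast card_le_of_natarajanShatters B.2
  exact ne_top_of_le_ne_top (ENat.natCast_ne_top _) h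

lemma card_le_toNat_natarajanDim {B : Finset 𝒳} (hB : NatarajanShatters (linClass 𝒳) B) :
    B.card ≤ (natarajanDim (linClass 𝒳)).toNat := by
  have h : (B.card : ℕ∞) ≤ natarajanDim (linClass 𝒳) :=
    le_iSup (fun B : {B : Finset 𝒳 // NatarajanShatters (linClass 𝒳) B} => (B.1.card : ℕ∞)) ⟨B, hB⟩
  have := ENat.toNat_le_toNat h (natarajanDim_linClass_ne_top 𝒳)
  simpa using this

/-- The bias coordinate makes both constant predictors available at any point. -/
lemma one_le_toNat_natarajanDim (hbias : ∀ x ∈ 𝒳, x (Fin.last m) = 1) (x₀ : 𝒳) :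
    1 ≤ (natarajanDim (linClass 𝒳)).toNat := by
  have hsh : NatarajanShatters (linClass 𝒳) {x₀} := by
    refine ⟨fun _ => 1, fun _ => -1, fun x _ => by simp, fun T hT => ?_⟩
    by_cases hx : x₀ ∈ T
    · refine ⟨_, ⟨0, rfl⟩, fun x hx' => ⟨fun _ => ?_, fun h => absurd ?_ h⟩⟩
      · simp [predict, linModel]
      · rwa [Finset.mem_singleton.1 hx']
    · refine ⟨_, ⟨-EuclideanSpace.single (Fin.last m) 1, rfl⟩,
        fun x hx' => ⟨fun h => ?_, fun _ => ?_⟩⟩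
      · rw [Finset.mem_singleton.1 hx'] at h
        exact absurd h hx
      · refine (predict_eq_iff _ _ _).2 (Or.inr ⟨?_, rfl⟩)
        have := linModel_single_last (x : Param m)
        rw [linModel_eq_inner] at this ⊢
        rw [inner_neg_right, this, hbias x x.2]
        norm_num
  simpa using card_le_toNat_natarajanDim hsh

/-- Data points whose traces are shattered have distinct feature vectors, and these are shattered
in the sense of Natarajan. -/
lemma tracesVCDimLE_correct (ι : Type*) [Fintype ι] {Θ : Type*} (τ : Set (Data 𝒳 S))
    (θ : Θ → Param m) :
    TracesVCDimLE ι τ (fun j => correct (θ j)) (natarajanDim (linClass 𝒳)).toNat := by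
  classical
  intro z B hB
  have hall : ∀ i ∈ B, z i ∈ τ := by
    obtain ⟨j, hj⟩ := hB B subset_rfl
    exact fun i hi => ((hj i hi).1 hi).1
  have hinj : Set.InjOn (fun i => (z i).1) B := by
    intro i hi i' hi' hii'
    by_contra hne
    obtain ⟨j, hj⟩ := hB B subset_rfl
    obtain ⟨j', hj'⟩ := hB {i} (Finset.singleton_subset_iff.2 hi)
    have h1 : predict (θ j) (z i).1 = (z i).2.2 := ((hj i hi).1 hi).2
    have h2 : predict (θ j) (z i').1 = (z i').2.2 := ((hj i' hi').1 hi').2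
    have h3 : predict (θ j') (z i).1 = (z i).2.2 := ((hj' i hi).1 (Finset.mem_singleton_self _)).2
    have hii : (z i).1 = (z i').1 := hii'
    have h4 : predict (θ j') (z i').1 = (z i').2.2 := by
      rw [← h2, ← hii, h1, h3]
    have h5 := (hj' i' hi').2 ⟨hall i' hi', h4⟩
    exact hne (Finset.mem_singleton.1 h5).symm
  rw [← Finset.card_image_of_injOn hinj]
  refine card_le_toNat_natarajanDim ?_
  obtain ⟨j₀, hj₀⟩ := hB B subset_rfl
  obtain ⟨j₁, hj₁⟩ := hB ∅ (Finset.empty_subset _)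
  have hf₀ : ∀ i ∈ B, predict (θ j₀) (z i).1 = (z i).2.2 := fun i hi => ((hj₀ i hi).1 hi).2
  have hf₁ : ∀ i ∈ B, predict (θ j₁) (z i).1 ≠ (z i).2.2 := fun i hi h =>
    absurd ((hj₁ i hi).2 ⟨hall i hi, h⟩) (Finset.notMem_empty _)
  refine ⟨fun x => predict (θ j₀) x, fun x => predict (θ j₁) x, fun x hx => ?_, fun T _ => ?_⟩
  · obtain ⟨i, hi, rfl⟩ := Finset.mem_image.1 hx
    simp only [hf₀ i hi]
    exact (hf₁ i hi).symm
  · obtain ⟨j, hj⟩ := hB (B.filter fun i => (z i).1 ∈ T) (Finset.filter_subset _ _)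
    refine ⟨fun x => predict (θ j) x, ⟨θ j, rfl⟩, fun x hx => ?_⟩
    obtain ⟨i, hi, rfl⟩ := Finset.mem_image.1 hx
    refine ⟨fun hT => ?_, fun hT => ?_⟩
    · simp only [hf₀ i hi]
      exact ((hj i hi).1 (Finset.mem_filter.2 ⟨hi, hT⟩)).2
    · refine units_int_eq_of_ne_of_ne (fun h => hT ?_) (hf₁ i hi)
      exact (Finset.mem_filter.1 ((hj i hi).2 ⟨hall i hi, h⟩)).2

/-- Every predictor is a pointwise limit of predictors of a fixed countable dense set of
parameters: the parameter is approached from the side of larger bias, fast enough that points on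
the decision boundary stay on the nonnegative side. -/
lemma exists_seq_predict_eventually_eq (θ : Param m) :
    ∃ j : ℕ → ℕ, ∀ x : Param m, x (Fin.last m) = 1 →
      ∀ᶠ i in Filter.atTop,
        predict (TopologicalSpace.denseSeq (Param m) (j i)) x = predict θ x := by
  let e : ℕ → ℝ := fun i => 1 / ((i : ℝ) + 1)
  have he : ∀ i, 0 < e i := fun i => by positivity
  have hlim : Filter.Tendsto e Filter.atTop (nhds 0) := tendsto_one_div_add_atTop_nhds_zero_nat
  let b : Param m := EuclideanSpace.single (Fin.last m) 1
  have hex : ∀ i, ∃ j, dist (θ + e i • b) (TopologicalSpace.denseSeq (Param m) j) < e i ^ 2 :=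
    fun i => (TopologicalSpace.denseRange_denseSeq (Param m)).exists_dist_lt _
      (pow_pos (he i) 2)
  choose j hj using hex
  refine ⟨j, fun x hx => ?_⟩
  have happ : ∀ i, |linModel (TopologicalSpace.denseSeq (Param m) (j i)) x - (linModel θ x + e i)| ≤
      e i ^ 2 * ‖x‖ := by
    intro i
    have h1 : linModel θ x + e i = linModel (θ + e i • b) x := by
      rw [linModel_add_smul, linModel_single_last, hx, mul_one]
    have h2 : linModel (TopologicalSpace.denseSeq (Param m) (j i)) x - linModel (θ + e i • b) x =
        linModel (TopologicalSpace.denseSeq (Param m) (j i) - (θ + e i • b)) x := by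
      simp only [linModel_eq_inner, inner_sub_right]
    rw [h1, h2]
    refine (abs_linModel_le _ _).trans ?_
    gcongr
    rw [← dist_eq_norm, dist_comm]
    exact (hj i).le
  by_cases h0 : 0 ≤ linModel θ x
  · have hev : ∀ᶠ i in Filter.atTop, e i * ‖x‖ < 1 := by
      have : Filter.Tendsto (fun i => e i * ‖x‖) Filter.atTop (nhds 0) := by
        simpa using hlim.mul_const ‖x‖
      exact this.eventually_lt_const one_pos
    filter_upwards [hev] with i hi
    have h1 := abs_le.1 (happ i)
    have h2 : e i ^ 2 * ‖x‖ ≤ e i := by nlinarith [he i]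
    have h3 : 0 ≤ linModel (TopologicalSpace.denseSeq (Param m) (j i)) x := by linarith
    simp [predict, h0, h3]
  · have hev : ∀ᶠ i in Filter.atTop, e i + e i ^ 2 * ‖x‖ < -linModel θ x := by
      have : Filter.Tendsto (fun i => e i + e i ^ 2 * ‖x‖) Filter.atTop (nhds 0) := by
        simpa using hlim.add ((hlim.pow 2).mul_const ‖x‖)
      exact this.eventually_lt_const (by linarith)
    filter_upwards [hev] with i hi
    have h1 := abs_le.1 (happ i)
    have h3 : ¬ 0 ≤ linModel (TopologicalSpace.denseSeq (Param m) (j i)) x := by linarith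
    simp [predict, h0, h3]

/-- A bound on the difference of the accuracies over two distributions extends from the dense
sequence of parameters to all parameters. -/
lemma abs_accuracy_sub_le_of_denseSeq [MeasurableSpace S]
    (hbias : ∀ x ∈ 𝒳, x (Fin.last m) = 1) (Q Q' : Measure (Data 𝒳 S))
    [IsFiniteMeasure Q] [IsFiniteMeasure Q'] {u : ℝ}
    (h : ∀ j, |accuracy (TopologicalSpace.denseSeq (Param m) j) Q -
      accuracy (TopologicalSpace.denseSeq (Param m) j) Q'| ≤ u) (θ : Param m) :
    |accuracy θ Q - accuracy θ Q'| ≤ u := by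
  obtain ⟨j, hj⟩ := exists_seq_predict_eventually_eq θ
  have hlim : ∀ (R : Measure (Data 𝒳 S)) [IsFiniteMeasure R],
      Filter.Tendsto (fun i => accuracy (TopologicalSpace.denseSeq (Param m) (j i)) R)
        Filter.atTop (nhds (accuracy θ R)) := by
    intro R _
    have := tendsto_measure_of_tendsto_indicator_of_isFiniteMeasure (L := Filter.atTop) R
      (As := fun i => correct (TopologicalSpace.denseSeq (Param m) (j i))) (A := correct θ)
      (fun i => measurableSet_correct _) (fun z => by
        filter_upwards [hj z.1 (hbias _ z.1.2)] with i hi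
        simp [correct, hi])
    exact (ENNReal.tendsto_toReal (measure_ne_top _ _)).comp this
  exact le_of_tendsto' ((hlim Q).sub (hlim Q')).abs fun i => h (j i)

end Data

/-! ### Gaussian perturbations of a linear model -/

lemma Phi_eq (t : ℝ) : Phi t = (gaussianReal 0 1).real (Set.Iic t) := cdf_eq_real _ _

lemma Phi_mono : Monotone Phi := monotone_cdf _

lemma Phi_nonneg (t : ℝ) : 0 ≤ Phi t := cdf_nonneg _ _

lemma Phi_le_one (t : ℝ) : Phi t ≤ 1 := cdf_le_one _ _

lemma gaussianReal_Iio_eq_Phi (t : ℝ) : (gaussianReal 0 1).real (Set.Iio t) = Phi t := by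
  have := nullSingletonClass_gaussianReal (μ := 0) (v := 1) one_ne_zero
  rw [Phi_eq]
  exact measureReal_congr Iio_ae_eq_Iic

lemma gaussianReal_Ici_neg_eq_Phi (t : ℝ) : (gaussianReal 0 1).real (Set.Ici (-t)) = Phi t := by
  have h := gaussianReal_map_neg (μ := 0) (v := 1)
  rw [neg_zero] at h
  rw [Phi_eq]
  conv_lhs => rw [← h]
  rw [map_measureReal_apply measurable_neg measurableSet_Ici]
  congr 1
  ext s
  simp

lemma Phi_neg (t : ℝ) : Phi (-t) = 1 - Phi t := by
  rw [← gaussianReal_Iio_eq_Phi, ← gaussianReal_Ici_neg_eq_Phi t, ← probReal_compl_eq_one_sub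
    measurableSet_Ici, Set.compl_Ici]

/-- The projection of a standard Gaussian vector on a unit direction is standard normal. -/
lemma stdGaussian_map_linModel_div {m : ℕ} {x : Param m} (hx : x ≠ 0) :
    (stdGaussian (Param m)).map (fun ξ => linModel ξ x / ‖x‖) = gaussianReal 0 1 := by
  let L : StrongDual ℝ (Param m) := ‖x‖⁻¹ • innerSL ℝ x
  have hL : (fun ξ => linModel ξ x / ‖x‖) = L := by
    funext ξ
    simp [L, linModel_eq_inner, div_eq_inv_mul]
  have hn : ‖L‖ = 1 := by
    simp only [L, norm_smul, innerSL_apply_norm, norm_inv, norm_norm]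
    exact inv_mul_cancel₀ (norm_ne_zero_iff.2 hx)
  rw [hL, IsGaussian.map_eq_gaussianReal, integral_strongDual_stdGaussian,
    variance_dual_stdGaussian, hn]
  simp

/-- The probability that the perturbed model is correct at a point is `Φ (α / σ)`. -/
lemma stdGaussian_predict_eq {m : ℕ} {σ : ℝ} (hσ : 0 < σ) (θ : Param m) {x : Param m} (hx : x ≠ 0)
    (y : ℤˣ) :
    (stdGaussian (Param m)).real {ξ | predict (θ + σ • ξ) x = y} = Phi (angMargin θ x y / σ) := by
  have hn : 0 < ‖x‖ := norm_pos_iff.2 hx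
  have hmeas : Measurable fun ξ : Param m => linModel ξ x / ‖x‖ :=
    (measurable_linModel measurable_id measurable_const).div_const _
  have hlin : ∀ ξ, linModel (θ + σ • ξ) x =
      σ * ‖x‖ * (linModel ξ x / ‖x‖ - -(linModel θ x / ‖x‖ / σ)) := fun ξ => by
    rw [linModel_add_smul]; field_simp; ring
  have hσn : 0 < σ * ‖x‖ := by positivity
  rcases Int.units_eq_one_or y with rfl | rfl
  · have h1 : {ξ | predict (θ + σ • ξ) x = 1} =
        (fun ξ : Param m => linModel ξ x / ‖x‖) ⁻¹' Set.Ici (-(linModel θ x / ‖x‖ / σ)) := by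
      ext ξ
      have : predict (θ + σ • ξ) x = 1 ↔ 0 ≤ linModel (θ + σ • ξ) x := by
        rw [predict_eq_iff]; simp
      simp only [Set.mem_ofPred_eq, Set.mem_preimage, Set.mem_Ici, this]
      rw [hlin, mul_nonneg_iff_of_pos_left hσn, sub_nonneg]
    rw [h1, ← map_measureReal_apply hmeas measurableSet_Ici, stdGaussian_map_linModel_div hx,
      gaussianReal_Ici_neg_eq_Phi]
    simp [angMargin, margin]
  · have h1 : {ξ | predict (θ + σ • ξ) x = -1} =
        (fun ξ : Param m => linModel ξ x / ‖x‖) ⁻¹' Set.Iio (-(linModel θ x / ‖x‖ / σ)) := by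
      ext ξ
      have : predict (θ + σ • ξ) x = -1 ↔ linModel (θ + σ • ξ) x < 0 := by
        rw [predict_eq_iff]; simp
      simp only [Set.mem_ofPred_eq, Set.mem_preimage, Set.mem_Iio, this]
      rw [hlin, ← mul_zero (σ * ‖x‖), mul_lt_mul_iff_right₀ hσn, sub_neg]
    rw [h1, ← map_measureReal_apply hmeas measurableSet_Iio, stdGaussian_map_linModel_div hx,
      gaussianReal_Iio_eq_Phi]
    simp [angMargin, margin, neg_div]

/-- Fubini for the measures of the two kinds of sections of a set. -/
lemma integral_measureReal_section_comm {α β : Type*} [MeasurableSpace α] [MeasurableSpace β]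
    (μ : Measure α) (ν : Measure β) [IsFiniteMeasure μ] [IsFiniteMeasure ν] {A : Set (α × β)}
    (hA : MeasurableSet A) :
    ∫ a, ν.real {b | (a, b) ∈ A} ∂μ = ∫ b, μ.real {a | (a, b) ∈ A} ∂ν := by
  have h1 : ∫ a, ν.real (Prod.mk a ⁻¹' A) ∂μ = (μ.prod ν).real A := by
    rw [measureReal_def, Measure.prod_apply hA]
    exact integral_toReal (measurable_measure_prodMk_left hA).aemeasurable
      (Filter.Eventually.of_forall fun a => measure_lt_top _ _)
  have h2 : ∫ b, μ.real ((fun a => (a, b)) ⁻¹' A) ∂ν = (μ.prod ν).real A := by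
    rw [measureReal_def, Measure.prod_apply_symm hA]
    exact integral_toReal (measurable_measure_prodMk_right hA).aemeasurable
      (Filter.Eventually.of_forall fun a => measure_lt_top _ _)
  exact h1.trans h2.symm

section Data

variable {m : ℕ} {𝒳 : Set (Param m)} {S : Type*}

lemma ne_zero_of_bias (hbias : ∀ x ∈ 𝒳, x (Fin.last m) = 1) (z : Data 𝒳 S) :
    (z.1 : Param m) ≠ 0 := fun h => by
  have := hbias _ z.1.2
  rw [h] at this
  simp at this

variable [MeasurableSpace S]

lemma measurableSet_correct_perturbed (θ : Param m) (σ : ℝ) :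
    MeasurableSet {q : Param m × Data 𝒳 S | q.2 ∈ correct (θ + σ • q.1)} :=
  measurableSet_predict_eq (by fun_prop)
    (measurable_subtype_coe.comp measurable_snd.fst) measurable_snd.snd.snd

lemma measurable_accuracy (θ : Param m) (σ : ℝ) (Q : Measure (Data 𝒳 S)) [IsFiniteMeasure Q] :
    Measurable fun ξ => accuracy (θ + σ • ξ) Q :=
  (measurable_measure_prodMk_left
    (measurableSet_correct_perturbed (𝒳 := 𝒳) (S := S) θ σ)).ennreal_toReal

lemma measurable_angMargin (θ : Param m) :
    Measurable fun z : Data 𝒳 S => angMargin θ z.1 z.2.2 := by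
  have h1 : Measurable fun z : Data 𝒳 S => linModel θ z.1 :=
    measurable_linModel measurable_const (measurable_subtype_coe.comp measurable_fst)
  have h2 : Measurable fun y : ℤˣ => ((y : ℤ) : ℝ) := fun s _ => measurableSet_units_int _
  exact ((h2.comp measurable_snd.snd).mul h1).div (measurable_subtype_coe.comp measurable_fst).norm

lemma integrable_accuracy_pow (θ : Param m) (σ : ℝ) (Q : Measure (Data 𝒳 S)) [IsFiniteMeasure Q]
    (r : ℕ) : Integrable (fun ξ => accuracy (θ + σ • ξ) Q ^ r) (stdGaussian (Param m)) :=
  Integrable.of_bound ((measurable_accuracy θ σ Q).pow_const r).aestronglyMeasurable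
    (Q.real Set.univ ^ r) (Filter.Eventually.of_forall fun ξ => by
      rw [Real.norm_eq_abs, abs_pow, abs_of_nonneg (by rw [accuracy_eq]; positivity)]
      gcongr
      · rw [accuracy_eq]; positivity
      · exact measureReal_mono (Set.subset_univ _))

/-- The mean accuracy of the perturbed models. -/
lemma integral_accuracy (hbias : ∀ x ∈ 𝒳, x (Fin.last m) = 1) (θ : Param m) {σ : ℝ} (hσ : 0 < σ)
    (Q : Measure (Data 𝒳 S)) [IsFiniteMeasure Q] :
    ∫ ξ, accuracy (θ + σ • ξ) Q ∂(stdGaussian (Param m)) = expAccuracy θ σ Q := by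
  refine (integral_measureReal_section_comm (stdGaussian (Param m)) Q
    (measurableSet_correct_perturbed θ σ)).trans ?_
  exact integral_congr_ae (Filter.Eventually.of_forall fun z =>
    stdGaussian_predict_eq hσ θ (ne_zero_of_bias hbias z) z.2.2)

lemma measurableSet_correct_pair (θ : Param m) (σ : ℝ) :
    MeasurableSet {q : Param m × (Data 𝒳 S × Data 𝒳 S) |
      q.2.1 ∈ correct (θ + σ • q.1) ∧ q.2.2 ∈ correct (θ + σ • q.1)} := by
  have h := measurableSet_correct_perturbed (𝒳 := 𝒳) (S := S) θ σ
  exact ((measurable_fst.prodMk measurable_snd.fst) h).inter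
    ((measurable_fst.prodMk measurable_snd.snd) h)

/-- The second moment of the accuracy of the perturbed models is the probability that they are
correct at two independent points. -/
lemma integral_accuracy_sq (θ : Param m) (σ : ℝ) (Q : Measure (Data 𝒳 S)) [IsFiniteMeasure Q] :
    ∫ ξ, accuracy (θ + σ • ξ) Q ^ 2 ∂(stdGaussian (Param m)) =
      ∫ w, (stdGaussian (Param m)).real
        {ξ | w.1 ∈ correct (θ + σ • ξ) ∧ w.2 ∈ correct (θ + σ • ξ)} ∂(Q.prod Q) := by
  refine Eq.trans ?_ (integral_measureReal_section_comm (stdGaussian (Param m)) (Q.prod Q)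
    (measurableSet_correct_pair θ σ))
  refine integral_congr_ae (Filter.Eventually.of_forall fun ξ => ?_)
  have : {w : Data 𝒳 S × Data 𝒳 S | w.1 ∈ correct (θ + σ • ξ) ∧ w.2 ∈ correct (θ + σ • ξ)} =
      correct (θ + σ • ξ) ×ˢ correct (θ + σ • ξ) := rfl
  simp only [accuracy_eq, Set.mem_ofPred_eq]
  rw [this, measureReal_prod_prod, sq]

/-- The variance of the accuracy of the perturbed models. At two points, both predictions are
correct with probability at most `min (Φ₁, Φ₂)`, and
`min (Φ₁, Φ₂) - Φ₁ Φ₂ = Φ (α_min / σ) Φ (-α_max / σ)`. -/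
lemma integral_sq_accuracy_sub_le (hbias : ∀ x ∈ 𝒳, x (Fin.last m) = 1) (θ : Param m) {σ : ℝ}
    (hσ : 0 < σ) (Q : Measure (Data 𝒳 S)) [IsFiniteMeasure Q] :
    ∫ ξ, (accuracy (θ + σ • ξ) Q - expAccuracy θ σ Q) ^ 2 ∂(stdGaussian (Param m)) ≤
      varAccuracy θ σ Q := by
  set γ := stdGaussian (Param m)
  set e := expAccuracy θ σ Q with he
  let Ψ : Data 𝒳 S → ℝ := fun z => Phi (angMargin θ z.1 z.2.2 / σ)
  have hΨm : Measurable Ψ := Phi_mono.measurable.comp ((measurable_angMargin θ).div_const σ)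
  have h1 : ∫ ξ, (accuracy (θ + σ • ξ) Q - e) ^ 2 ∂γ =
      ∫ ξ, accuracy (θ + σ • ξ) Q ^ 2 ∂γ - e ^ 2 := by
    have hint1 : Integrable (fun ξ => accuracy (θ + σ • ξ) Q) γ := by
      simpa only [pow_one] using integrable_accuracy_pow θ σ Q 1
    have h2 : ∀ ξ, (accuracy (θ + σ • ξ) Q - e) ^ 2 =
        accuracy (θ + σ • ξ) Q ^ 2 - 2 * e * accuracy (θ + σ • ξ) Q + e ^ 2 := fun ξ => by ring
    simp_rw [h2]
    have hint2 : Integrable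
        (fun ξ => accuracy (θ + σ • ξ) Q ^ 2 - 2 * e * accuracy (θ + σ • ξ) Q) γ :=
      (integrable_accuracy_pow θ σ Q 2).sub (hint1.const_mul _)
    rw [integral_add hint2 (integrable_const _),
      integral_sub (integrable_accuracy_pow θ σ Q 2) (hint1.const_mul _),
      integral_const_mul, integral_accuracy hbias θ hσ Q]
    simp only [integral_const, probReal_univ, smul_eq_mul, one_mul]
    ring
  have h2 : e ^ 2 = ∫ w, Ψ w.1 * Ψ w.2 ∂(Q.prod Q) := by
    rw [integral_prod_mul, sq]
    rfl
  rw [h1, h2, integral_accuracy_sq, varAccuracy]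
  have hbound : ∀ {f : Data 𝒳 S × Data 𝒳 S → ℝ}, Measurable f → (∀ w, 0 ≤ f w) → (∀ w, f w ≤ 1) →
      Integrable f (Q.prod Q) := fun hf h0 h1 =>
    Integrable.of_bound hf.aestronglyMeasurable 1 (Filter.Eventually.of_forall fun w => by
      rw [Real.norm_eq_abs, abs_of_nonneg (h0 w)]; exact h1 w)
  have hint2 : Integrable (fun w : Data 𝒳 S × Data 𝒳 S => γ.real
      {ξ | w.1 ∈ correct (θ + σ • ξ) ∧ w.2 ∈ correct (θ + σ • ξ)}) (Q.prod Q) :=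
    hbound (measurable_measure_prodMk_right
      (measurableSet_correct_pair (𝒳 := 𝒳) (S := S) θ σ)).ennreal_toReal
      (fun w => measureReal_nonneg) (fun w => measureReal_le_one)
  have hint3 : Integrable (fun w : Data 𝒳 S × Data 𝒳 S => Ψ w.1 * Ψ w.2) (Q.prod Q) :=
    hbound ((hΨm.comp measurable_fst).mul (hΨm.comp measurable_snd))
      (fun w => mul_nonneg (Phi_nonneg _) (Phi_nonneg _))
      (fun w => mul_le_one₀ (Phi_le_one _) (Phi_nonneg _) (Phi_le_one _))
  rw [← integral_sub hint2 hint3]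
  refine integral_mono (hint2.sub hint3) (hbound ?_
    (fun w => mul_nonneg (Phi_nonneg _) (Phi_nonneg _))
    (fun w => mul_le_one₀ (Phi_le_one _) (Phi_nonneg _) (Phi_le_one _))) fun w => ?_
  · have ha : Measurable fun w : Data 𝒳 S × Data 𝒳 S => angMargin θ w.1.1 w.1.2.2 :=
      (measurable_angMargin θ).comp measurable_fst
    have hb : Measurable fun w : Data 𝒳 S × Data 𝒳 S => angMargin θ w.2.1 w.2.2.2 :=
      (measurable_angMargin θ).comp measurable_snd
    exact (Phi_mono.measurable.comp ((ha.min hb).div_const σ)).mul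
      (Phi_mono.measurable.comp ((ha.max hb).neg.div_const σ))
  · have hP : ∀ z : Data 𝒳 S, γ.real {ξ | z ∈ correct (θ + σ • ξ)} = Ψ z := fun z =>
      stdGaussian_predict_eq hσ θ (ne_zero_of_bias hbias z) z.2.2
    have hb1 : γ.real {ξ | w.1 ∈ correct (θ + σ • ξ) ∧ w.2 ∈ correct (θ + σ • ξ)} ≤ Ψ w.1 := by
      rw [← hP]; exact measureReal_mono fun ξ h => h.1
    have hb2 : γ.real {ξ | w.1 ∈ correct (θ + σ • ξ) ∧ w.2 ∈ correct (θ + σ • ξ)} ≤ Ψ w.2 := by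
      rw [← hP]; exact measureReal_mono fun ξ h => h.2
    simp only [Ψ] at hb1 hb2 ⊢
    rw [neg_div, Phi_neg]
    rcases le_total (angMargin θ w.1.1 w.1.2.2) (angMargin θ w.2.1 w.2.2.2) with h | h
    · rw [min_eq_left h, max_eq_right h]
      linarith
    · rw [min_eq_right h, max_eq_left h]
      linarith

end Data

/-- The Cauchy–Schwarz inequality for bounded functions. -/
lemma abs_integral_mul_le {Ω : Type*} [MeasurableSpace Ω] (μ : Measure Ω) {Y Z : Ω → ℝ}
    (hY : Integrable (fun ω => Y ω ^ 2) μ) (hZ : Integrable (fun ω => Z ω ^ 2) μ)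
    (hYZ : Integrable (fun ω => Y ω * Z ω) μ) :
    |∫ ω, Y ω * Z ω ∂μ| ≤ √(∫ ω, Y ω ^ 2 ∂μ) * √(∫ ω, Z ω ^ 2 ∂μ) := by
  have hquad : ∀ t : ℝ, 0 ≤ (∫ ω, Y ω ^ 2 ∂μ) * (t * t) + (2 * ∫ ω, Y ω * Z ω ∂μ) * t +
      ∫ ω, Z ω ^ 2 ∂μ := by
    intro t
    have h : 0 ≤ ∫ ω, (t * Y ω + Z ω) ^ 2 ∂μ := integral_nonneg fun ω => sq_nonneg _
    have h2 : ∀ ω, (t * Y ω + Z ω) ^ 2 = t * t * Y ω ^ 2 + (2 * t) * (Y ω * Z ω) + Z ω ^ 2 :=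
      fun ω => by ring
    simp_rw [h2] at h
    have h3 : Integrable (fun ω => t * t * Y ω ^ 2 + 2 * t * (Y ω * Z ω)) μ :=
      (hY.const_mul _).add (hYZ.const_mul _)
    rw [integral_add h3 hZ,
      integral_add (hY.const_mul _) (hYZ.const_mul _), integral_const_mul, integral_const_mul] at h
    linarith
  have hd := discrim_le_zero hquad
  rw [discrim] at hd
  rw [← Real.sqrt_mul (integral_nonneg fun ω => sq_nonneg _), ← Real.sqrt_sq_eq_abs]
  exact Real.sqrt_le_sqrt (by linarith)

/-- The triangle inequality in `L²`, for a linear combination. -/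
lemma integral_sq_sum_le {Ω κ : Type*} [MeasurableSpace Ω] [Fintype κ] (μ : Measure Ω)
    {Y : κ → Ω → ℝ} {V c : κ → ℝ} (hint : ∀ k l, Integrable (fun ω => Y k ω * Y l ω) μ)
    (hV : ∀ k, ∫ ω, Y k ω ^ 2 ∂μ ≤ V k) :
    ∫ ω, (∑ k, c k * Y k ω) ^ 2 ∂μ ≤ (∑ k, |c k| * √(V k)) ^ 2 := by
  have hsq : ∀ k, Integrable (fun ω => Y k ω ^ 2) μ := fun k => by
    simpa only [sq] using hint k k
  have h1 : ∀ ω, (∑ k, c k * Y k ω) ^ 2 = ∑ k, ∑ l, c k * c l * (Y k ω * Y l ω) := fun ω => by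
    rw [sq, Finset.sum_mul_sum]
    exact Finset.sum_congr rfl fun k _ => Finset.sum_congr rfl fun l _ => by ring
  simp_rw [h1]
  rw [integral_finsetSum _ fun k _ => integrable_finsetSum _ fun l _ => (hint k l).const_mul _,
    sq, Finset.sum_mul_sum]
  refine Finset.sum_le_sum fun k _ => ?_
  rw [integral_finsetSum _ fun l _ => (hint k l).const_mul _]
  refine Finset.sum_le_sum fun l _ => ?_
  rw [integral_const_mul]
  refine (le_abs_self _).trans ?_
  rw [abs_mul, abs_mul]
  calc |c k| * |c l| * |∫ ω, Y k ω * Y l ω ∂μ|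
      ≤ |c k| * |c l| * (√(V k) * √(V l)) := by
        gcongr
        refine (abs_integral_mul_le μ (hsq k) (hsq l) (hint k l)).trans ?_
        gcongr
        · exact hV k
        · exact hV l
    _ = _ := by ring

/-- Chebyshev's inequality, with a bound on the second moment that may vanish. -/
lemma measureReal_sqrt_div_lt_abs_le {Ω : Type*} [MeasurableSpace Ω] (μ : Measure Ω)
    [IsFiniteMeasure μ] {W : Ω → ℝ} (hW : Integrable (fun ω => W ω ^ 2) μ) {V ζ : ℝ}
    (hV : ∫ ω, W ω ^ 2 ∂μ ≤ V) (hζ : 0 < ζ) : μ.real {ω | √(V / ζ) < |W ω|} ≤ ζ := by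
  have h0 : 0 ≤ ∫ ω, W ω ^ 2 ∂μ := integral_nonneg fun ω => sq_nonneg _
  rcases (h0.trans hV).eq_or_lt with hV0 | hVpos
  · rw [← hV0] at hV ⊢
    have h1 := (integral_eq_zero_iff_of_nonneg (fun ω => sq_nonneg _) hW).1 (le_antisymm hV h0)
    have h2 : μ {ω | √(0 / ζ) < |W ω|} = 0 := by
      refine measure_mono_null (fun ω hω => ?_) h1
      intro h
      have h3 : W ω = 0 := by simpa using h
      simp [h3] at hω
    rw [measureReal_def, h2]
    simpa using hζ.le
  · have hmk := mul_meas_ge_le_integral_of_nonneg (μ := μ)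
      (Filter.Eventually.of_forall fun ω => sq_nonneg (W ω)) hW (V / ζ)
    have hsub : {ω | √(V / ζ) < |W ω|} ⊆ {ω | V / ζ ≤ W ω ^ 2} := by
      intro ω hω
      have h1 : √(V / ζ) ^ 2 ≤ |W ω| ^ 2 := by
        gcongr
        exact le_of_lt hω
      rwa [Real.sq_sqrt (by positivity), sq_abs] at h1
    have h2 : V / ζ * μ.real {ω | √(V / ζ) < |W ω|} ≤ V := by
      refine le_trans ?_ (hmk.trans hV)
      exact mul_le_mul_of_nonneg_left (measureReal_mono hsub) (by positivity)
    have h3 : V / ζ * μ.real {ω | √(V / ζ) < |W ω|} = V * (μ.real {ω | √(V / ζ) < |W ω|} / ζ) := by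
      ring
    rw [h3] at h2
    have h4 : μ.real {ω | √(V / ζ) < |W ω|} / ζ ≤ 1 := by
      by_contra! h
      nlinarith
    rwa [div_le_one hζ] at h4

/-- The fairness of the perturbed models concentrates around its mean over any fixed
distribution. -/
theorem withProb_abs_fairness_sub_expFairness_le {m K : ℕ} {𝒳 : Set (Param m)} {S : Type*}
    [MeasurableSpace S] (hbias : ∀ x ∈ 𝒳, x (Fin.last m) = 1) (c : Fin (K + 1) → ℝ)
    (τ : Fin K → Set (Data 𝒳 S)) (θ : Param m) {σ ζ : ℝ} (hσ : 0 < σ) (hζ : 0 < ζ)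
    (Q : Measure (Data 𝒳 S)) :
    WithProb (stdGaussian (Param m)) ζ fun ξ =>
      |fairness c τ (θ + σ • ξ) Q - expFairness c τ θ σ Q| ≤ √(varFairness c τ θ σ Q / ζ) := by
  let Y : Fin K → Param m → ℝ := fun k ξ =>
    accuracy (θ + σ • ξ) (cond Q (τ k)) - expAccuracy θ σ (cond Q (τ k))
  have hYm : ∀ k, Measurable (Y k) := fun k => (measurable_accuracy θ σ _).sub_const _
  have hYb : ∀ k ξ, |Y k ξ| ≤ 1 + |expAccuracy θ σ (cond Q (τ k))| := fun k ξ => by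
    refine (abs_sub _ _).trans ?_
    gcongr
    rw [accuracy_eq, abs_of_nonneg measureReal_nonneg]
    exact measureReal_le_one
  have hint : ∀ k l, Integrable (fun ξ => Y k ξ * Y l ξ) (stdGaussian (Param m)) := fun k l =>
    Integrable.of_bound ((hYm k).mul (hYm l)).aestronglyMeasurable
      ((1 + |expAccuracy θ σ (cond Q (τ k))|) * (1 + |expAccuracy θ σ (cond Q (τ l))|))
      (Filter.Eventually.of_forall fun ξ => by
        rw [Real.norm_eq_abs, abs_mul]
        gcongr
        · exact hYb k ξ
        · exact hYb l ξ)
  let W : Param m → ℝ := fun ξ => ∑ k, c k.succ * Y k ξ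
  have hWm : Measurable W := Finset.measurable_fun_sum _ fun k _ => (hYm k).const_mul _
  have hWint : Integrable (fun ξ => W ξ ^ 2) (stdGaussian (Param m)) := by
    have h1 : ∀ ξ, W ξ ^ 2 = ∑ k, ∑ l, c k.succ * c l.succ * (Y k ξ * Y l ξ) := fun ξ => by
      rw [sq, Finset.sum_mul_sum]
      exact Finset.sum_congr rfl fun k _ => Finset.sum_congr rfl fun l _ => by ring
    simp_rw [h1]
    exact integrable_finsetSum _ fun k _ => integrable_finsetSum _ fun l _ =>
      (hint k l).const_mul _
  have hWV : ∫ ξ, W ξ ^ 2 ∂(stdGaussian (Param m)) ≤ varFairness c τ θ σ Q :=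
    integral_sq_sum_le _ hint fun k => integral_sq_accuracy_sub_le hbias θ hσ _
  have hdiff : ∀ ξ, fairness c τ (θ + σ • ξ) Q - expFairness c τ θ σ Q = W ξ := fun ξ => by
    simp only [fairness, expFairness, W, Y, mul_sub, Finset.sum_sub_distrib]
    ring
  have hmeas : MeasurableSet {ξ | √(varFairness c τ θ σ Q / ζ) < |W ξ|} :=
    measurableSet_lt measurable_const hWm.abs
  refine ⟨{ξ | √(varFairness c τ θ σ Q / ζ) < |W ξ|}ᶜ, hmeas.compl, ?_, fun ξ hξ => ?_⟩
  · rw [probReal_compl_eq_one_sub hmeas]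
    have := measureReal_sqrt_div_lt_abs_le _ hWint hWV hζ
    linarith
  · show |fairness c τ (θ + σ • ξ) Q - expFairness c τ θ σ Q| ≤ _
    rw [hdiff]
    exact not_lt.1 hξ

/-! ### Uniform deviations of the accuracy and comparison of fairness measures -/

section Empirical

variable {m n : ℕ} {𝒳 : Set (Param m)} {S : Type*} [MeasurableSpace S]

lemma empirical_real (D : Fin n → Data 𝒳 S) {s : Set (Data 𝒳 S)} (hs : MeasurableSet s) :
    (empirical D).real s = (hits s D).card / n := by
  classical
  rw [measureReal_def, empirical, Measure.smul_apply, Measure.finsetSum_apply, smul_eq_mul,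
    ENNReal.toReal_mul, ENNReal.toReal_inv, ENNReal.toReal_natCast, div_eq_inv_mul, card_hits,
    ENNReal.toReal_sum fun i _ => measure_ne_top _ _]
  congr 1
  refine Finset.sum_congr rfl fun i _ => ?_
  rw [Measure.dirac_apply' _ hs]
  by_cases h : D i ∈ s <;> simp [h]

lemma accuracy_cond {τ : Set (Data 𝒳 S)} (hτ : MeasurableSet τ) (θ : Param m)
    (Q : Measure (Data 𝒳 S)) : accuracy θ (cond Q τ) = Q.real (τ ∩ correct θ) / Q.real τ := by
  rw [accuracy_eq, measureReal_def, cond_apply hτ, ENNReal.toReal_mul, ENNReal.toReal_inv,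
    div_eq_inv_mul]
  rfl

lemma accuracy_nonneg (θ : Param m) (Q : Measure (Data 𝒳 S)) : 0 ≤ accuracy θ Q :=
  measureReal_nonneg

lemma accuracy_cond_le_one (θ : Param m) (Q : Measure (Data 𝒳 S)) (τ : Set (Data 𝒳 S)) :
    accuracy θ (cond Q τ) ≤ 1 := measureReal_le_one

/-- The accuracy over one group, uniformly over all models: unless the sample has too few points in
the group or a centred sum over the dense sequence of models is large, the empirical accuracy
differs from the true one by at most a multiple of `√(L / (n P(τ)))`. -/
theorem exists_event_abs_accuracy_cond_sub_le (hbias : ∀ x ∈ 𝒳, x (Fin.last m) = 1)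
    (P : Measure (Data 𝒳 S)) [IsProbabilityMeasure P] {τ : Set (Data 𝒳 S)}
    (hτ : MeasurableSet τ) (hp : 0 < P.real τ) (hn : 0 < n) {L : ℝ} (hL : linDim 𝒳 ≤ L) :
    ∃ G : Set (Fin n → Data 𝒳 S), MeasurableSet G ∧
      (sampleLaw n P).real Gᶜ ≤ Real.exp (-(n * P.real τ / 8)) + Real.exp (-L) ∧
      ∀ D ∈ G, ∀ θ, |accuracy θ (cond P τ) - accuracy θ (cond (empirical D) τ)| ≤
        208 * √(L / (n * P.real τ)) := by
  have hn' : (0 : ℝ) < n := by exact_mod_cast hn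
  set q : ℝ := n * P.real τ with hq
  have hq0 : 0 < q := by positivity
  rcases lt_or_ge (2 * q) L with hcase | hcase
  · -- the asserted bound exceeds one
    refine ⟨Set.univ, MeasurableSet.univ, ?_, fun D _ θ => ?_⟩
    · rw [Set.compl_univ, measureReal_empty]
      positivity
    · have h1 : 1 ≤ √(L / q) := by
        rw [Real.one_le_sqrt, le_div_iff₀ hq0]
        linarith
      have h2 := accuracy_nonneg θ (cond P τ)
      have h3 := accuracy_nonneg θ (cond (empirical D) τ)
      have h4 := accuracy_cond_le_one θ P τ
      have h5 := accuracy_cond_le_one θ (empirical D) τ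
      refine (abs_le.2 ⟨?_, ?_⟩ : _ ≤ (1 : ℝ)).trans ?_ <;> linarith
  obtain ⟨z₀⟩ : Nonempty (Data 𝒳 S) := nonempty_of_isProbabilityMeasure P
  let θs := TopologicalSpace.denseSeq (Param m)
  let G : ℕ → Set (Data 𝒳 S) := fun j => correct (θs j)
  have hG : ∀ j, MeasurableSet (G j) := fun j => measurableSet_correct _
  let E₁ : Set (Fin n → Data 𝒳 S) := {D | ((hits τ D).card : ℝ) < q / 2}
  let E₂ : Set (Fin n → Data 𝒳 S) :=
    {D | ∃ j, 104 * √(L * q) < |∑ i, centred P τ G (D i) j|}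
  have hE₁m : MeasurableSet E₁ := measurableSet_lt (measurable_card_hits hτ) measurable_const
  have hE₂m : MeasurableSet E₂ := by
    simp only [E₂, Set.ofPred_exists]
    refine MeasurableSet.iUnion fun j => measurableSet_lt measurable_const
      (Finset.measurable_fun_sum _ fun i _ => ?_).abs
    exact (measurable_pi_apply j).comp ((measurable_centred P hτ hG).comp (measurable_pi_apply i))
  have hE₁ : (sampleLaw n P).real E₁ ≤ Real.exp (-(q / 8)) := by
    have := measureReal_card_hits_lt_le (ι := Fin n) P hτ
    rwa [Fintype.card_fin] at this
  have hE₂ : (sampleLaw n P).real E₂ ≤ Real.exp (-L) := by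
    have := measureReal_exists_centred_le (ι := Fin n) P hτ hp hG
      (one_le_toNat_natarajanDim hbias z₀.1) (tracesVCDimLE_correct (Fin n) τ θs)
      (L := L) hL (by rwa [Fintype.card_fin])
    rwa [Fintype.card_fin] at this
  refine ⟨(E₁ ∪ E₂)ᶜ, (hE₁m.union hE₂m).compl, ?_, fun D hD => ?_⟩
  · rw [compl_compl]
    exact (measureReal_union_le _ _).trans (add_le_add hE₁ hE₂)
  · simp only [Set.compl_union, Set.mem_inter_iff, Set.mem_compl_iff, E₁, E₂, Set.mem_ofPred_eq,
      not_lt, not_exists] at hD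
    obtain ⟨hD₁, hD₂⟩ := hD
    refine abs_accuracy_sub_le_of_denseSeq hbias _ _ fun j => ?_
    have h1 := hD₂ j
    rw [sum_centred] at h1
    have hN : (0 : ℝ) < (hits τ D).card := by linarith
    have h2 : accuracy (θs j) (cond P τ) - accuracy (θs j) (cond (empirical D) τ) =
        -(((hits (τ ∩ G j) D).card - P.real (τ ∩ G j) / P.real τ * (hits τ D).card) /
          (hits τ D).card) := by
      rw [accuracy_cond hτ, accuracy_cond hτ, empirical_real D hτ,
        empirical_real D (hτ.inter (measurableSet_correct _))]
      simp only [G]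
      field_simp
      ring
    rw [h2, abs_neg, abs_div, abs_of_pos hN, div_le_iff₀ hN]
    refine h1.trans ?_
    have h3 : √(L * q) = √(L / q) * q := by
      rw [show L * q = L / q * q ^ 2 by field_simp, Real.sqrt_mul' _ (by positivity),
        Real.sqrt_sq hq0.le]
    rw [h3]
    have h4 : 0 ≤ √(L / q) := Real.sqrt_nonneg _
    nlinarith

end Empirical

section Fairness

variable {m K : ℕ} {𝒳 : Set (Param m)} {S : Type*} [MeasurableSpace S]

lemma abs_fairness_sub_le_sum_abs_sub (c c' : Fin (K + 1) → ℝ) (τ : Fin K → Set (Data 𝒳 S))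
    (θ : Param m) (Q : Measure (Data 𝒳 S)) :
    |fairness c τ θ Q - fairness c' τ θ Q| ≤ ∑ k, |c k - c' k| := by
  have h1 : fairness c τ θ Q - fairness c' τ θ Q =
      (c 0 - c' 0) + ∑ k : Fin K, (c k.succ - c' k.succ) * accuracy θ (cond Q (τ k)) := by
    simp only [fairness, sub_mul, Finset.sum_sub_distrib]
    ring
  rw [h1, Fin.sum_univ_succ]
  refine (abs_add_le _ _).trans (add_le_add_right ((Finset.abs_sum_le_sum_abs _ _).trans
    (Finset.sum_le_sum fun k _ => ?_)) _)
  rw [abs_mul, abs_of_nonneg (accuracy_nonneg _ _)]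
  exact mul_le_of_le_one_right (abs_nonneg _) (accuracy_cond_le_one _ _ _)

lemma abs_fairness_sub_le_sum_mul (c : Fin (K + 1) → ℝ) (τ : Fin K → Set (Data 𝒳 S))
    (θ : Param m) (Q Q' : Measure (Data 𝒳 S)) {u : Fin K → ℝ}
    (h : ∀ k, |accuracy θ (cond Q (τ k)) - accuracy θ (cond Q' (τ k))| ≤ u k) :
    |fairness c τ θ Q - fairness c τ θ Q'| ≤ ∑ k : Fin K, |c k.succ| * u k := by
  have h1 : fairness c τ θ Q - fairness c τ θ Q' =
      ∑ k : Fin K, c k.succ * (accuracy θ (cond Q (τ k)) - accuracy θ (cond Q' (τ k))) := by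
    simp only [fairness, mul_sub, Finset.sum_sub_distrib]
    ring
  rw [h1]
  refine (Finset.abs_sum_le_sum_abs _ _).trans (Finset.sum_le_sum fun k _ => ?_)
  rw [abs_mul]
  gcongr
  exact h k

lemma WithProb.mono {Ω : Type*} [MeasurableSpace Ω] {μ : Measure Ω} {δ : ℝ} {p q : Ω → Prop}
    (h : WithProb μ δ p) (hpq : ∀ ω, p ω → q ω) : WithProb μ δ q := by
  obtain ⟨G, hG, hδ, hp⟩ := h
  exact ⟨G, hG, hδ, fun ω hω => hpq ω (hp ω hω)⟩

/-- A union bound over finitely many measurable events and one event that need not be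
measurable. -/
lemma exists_measurableSet_of_sum_le {Ω κ : Type*} [MeasurableSpace Ω] [Fintype κ] (μ : Measure Ω)
    [IsProbabilityMeasure μ] {G : κ → Set Ω} (hG : ∀ k, MeasurableSet (G k)) (B : Set Ω) {δ : ℝ}
    (hδ : ∑ k, μ.real (G k)ᶜ + μ.real B ≤ δ) :
    ∃ E, MeasurableSet E ∧ 1 - δ ≤ μ.real E ∧ ∀ ω ∈ E, (∀ k, ω ∈ G k) ∧ ω ∉ B := by
  have hm : MeasurableSet (⋃ k, (G k)ᶜ) := MeasurableSet.iUnion fun k => (hG k).compl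
  have hm' := hm.union (measurableSet_toMeasurable μ B)
  refine ⟨((⋃ k, (G k)ᶜ) ∪ toMeasurable μ B)ᶜ, hm'.compl, ?_, fun ω hω => ?_⟩
  · rw [probReal_compl_eq_one_sub hm']
    have h1 : μ.real (toMeasurable μ B) = μ.real B := by
      rw [measureReal_def, measure_toMeasurable, measureReal_def]
    have h2 := measureReal_union_le (μ := μ) (⋃ k, (G k)ᶜ) (toMeasurable μ B)
    have h3 := measureReal_iUnion_fintype_le (μ := μ) fun k => (G k)ᶜ
    linarith
  · rw [Set.compl_union] at hω
    refine ⟨fun k => ?_, fun hB => hω.2 (subset_toMeasurable μ B hB)⟩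
    by_contra hk
    exact hω.1 (Set.mem_iUnion.2 ⟨k, hk⟩)

end Fairness

/-- The deviation of the estimated constants has size `√(b ℓ / n)` where
`b = (log (max B₃ 1) + 1) / B₄`; at this level the assumed tail bound is at most `exp (-ℓ)`. -/
lemma mul_exp_tail_le {B₃ B₄ ℓ x : ℝ} (hB₄ : 0 < B₄) (hℓ : 1 ≤ ℓ) (hx : 0 < x) :
    B₃ * Real.exp (-B₄ * √((Real.log (max B₃ 1) + 1) / B₄ * ℓ / x) ^ 2 * x) ≤ Real.exp (-ℓ) := by
  set M := max B₃ 1 with hM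
  have hM1 : 1 ≤ M := le_max_right _ _
  have hlog : 0 ≤ Real.log M := Real.log_nonneg hM1
  rw [Real.sq_sqrt (by positivity)]
  have h1 : -B₄ * ((Real.log M + 1) / B₄ * ℓ / x) * x = -((Real.log M + 1) * ℓ) := by
    field_simp
  rw [h1]
  calc B₃ * Real.exp (-((Real.log M + 1) * ℓ)) ≤ M * Real.exp (-(Real.log M + ℓ)) := by
        gcongr
        · exact le_max_left _ _
        · nlinarith
    _ = Real.exp (-ℓ) := by
        rw [neg_add, Real.exp_add, Real.exp_neg, Real.exp_log (by linarith), ← mul_assoc,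
          mul_inv_cancel₀ (by linarith), one_mul]

end DPFair

end

/-! ### The deviation of the fairness of the released model -/

theorem mainTheorem7 (B₃ B₄ s : ℝ) (hB₃ : 0 < B₃) (hB₄ : 0 < B₄) (hs : 0 < s) :
    ∃ A a : ℝ, 0 < A ∧ 0 < a ∧
      ∀ (m K n : ℕ) (S : Type*) [MeasurableSpace S] (𝒳 : Set (DPFair.Param m))
        (_ : ∀ x ∈ 𝒳, x (Fin.last m) = 1)
        (P : Measure (DPFair.Data 𝒳 S)) [IsProbabilityMeasure P]
        (τ : Fin K → Set (DPFair.Data 𝒳 S)) (_ : DPFair.IsGroupPartition τ)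
        (_ : ∀ k' : Fin K, 0 < P.real (τ k'))
        (C : Fin K → Fin (K + 1) → ℝ) (k : Fin K)
        (_ : s ≤ ∑ k' : Fin K, |C k k'.succ|)
        (Chat : (Fin n → DPFair.Data 𝒳 S) → Fin K → Fin (K + 1) → ℝ)
        (_ : ∀ αC : ℝ, 0 < αC →
          (DPFair.sampleLaw n P).real
              {D | αC < ∑ k' : Fin (K + 1), |C k k' - Chat D k k'|} ≤
            B₃ * Real.exp (-B₄ * αC ^ 2 * n))
        (M : (Fin n → DPFair.Data 𝒳 S) → DPFair.Param m)
        (σ κ ζ : ℝ) (_ : 0 < σ) (_ : 0 < κ) (_ : κ < 1) (_ : 0 < ζ) (_ : ζ < 1)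
        (_ : 8 * Real.log ((2 * K + 1) / κ) / (⨅ k' : Fin K, P.real (τ k')) ≤ n)
        (_ : a * Real.log ((2 * K + 1) / κ) ≤ n),
        DPFair.WithProb (DPFair.sampleLaw n P) κ fun D =>
          DPFair.WithProb (stdGaussian (DPFair.Param m)) ζ fun ξ =>
            |DPFair.fairness (C k) τ (M D + σ • ξ) P -
                DPFair.expFairness (Chat D k) τ (M D) σ (DPFair.empirical D)| ≤
              √(DPFair.varFairness (Chat D k) τ (M D) σ (DPFair.empirical D) / ζ) +
                A * ∑ k' : Fin K, |Chat D k k'.succ| *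
                  √((DPFair.linDim 𝒳 + Real.log (K / κ)) / (n * P.real (τ k'))) := by
  -- the estimated constants are accurate up to `√(b ℓ / n)`, where `ℓ = log ((2 K + 1) / κ)`
  set b : ℝ := (Real.log (max B₃ 1) + 1) / B₄ with hb
  have hb0 : 0 < b := by
    have : 0 ≤ Real.log (max B₃ 1) := Real.log_nonneg (le_max_right _ _)
    positivity
  -- `a` makes this error at most `s / 2`; in `A`, the factor `√3` replaces `log (3 K / κ)` by
  -- `d + log (K / κ)`, and `2 / s` compensates for the sum of the estimated constants
  refine ⟨208 * √3 + 2 / s * √(3 * b), 4 * b / s ^ 2, by positivity, by positivity, ?_⟩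
  intro m K n S _ 𝒳 hbias P _ τ hτ hp C k hC Chat hChat M σ κ ζ hσ hκ0 hκ1 hζ0 hζ1 hn1 hn2
  have hK : (1 : ℝ) ≤ K := by
    have : 1 ≤ K := by have := k.2; omega
    exact_mod_cast this
  set ℓ := Real.log ((2 * K + 1) / κ) with hℓ
  have hℓ1 : 1 ≤ ℓ := by
    rw [hℓ, Real.le_log_iff_exp_le (by positivity), le_div_iff₀ hκ0]
    have := Real.exp_one_lt_d9
    nlinarith [Real.exp_pos 1]
  have hnpos : (0 : ℝ) < n := lt_of_lt_of_le (by positivity) hn2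
  have hn : 0 < n := by exact_mod_cast hnpos
  have hexpℓ : Real.exp (-ℓ) = κ / (2 * K + 1) := by
    rw [Real.exp_neg, Real.exp_log (by positivity), inv_div]
  -- `d ≥ 1` is the Natarajan dimension
  obtain ⟨z₀⟩ : Nonempty (DPFair.Data 𝒳 S) := nonempty_of_isProbabilityMeasure P
  have hd1 : 1 ≤ DPFair.linDim 𝒳 := by
    unfold DPFair.linDim
    exact_mod_cast DPFair.one_le_toNat_natarajanDim hbias z₀.1
  set d := DPFair.linDim 𝒳 with hd
  have hlogK : 0 ≤ Real.log (K / κ) := Real.log_nonneg (by rw [le_div_iff₀ hκ0]; linarith)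
  have hlog3 : Real.log (3 * K / κ) ≤ 2 + Real.log (K / κ) := by
    rw [mul_div_assoc, Real.log_mul (by norm_num) (by positivity)]
    have := Real.log_le_sub_one_of_pos (show (0 : ℝ) < 3 by norm_num)
    linarith
  have hℓ3 : ℓ ≤ Real.log (3 * K / κ) :=
    Real.log_le_log (by positivity) (by gcongr; linarith)
  set L := d + Real.log (3 * K / κ) with hL
  set q := d + Real.log (K / κ) with hq
  have hLq : L ≤ 3 * q := by linarith
  have hℓq : ℓ ≤ 3 * q := by linarith
  have hq0 : 0 < q := by linarith
  have hexpL : Real.exp (-L) ≤ Real.exp (-ℓ) := Real.exp_le_exp.2 (by linarith)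
  have hnp : ∀ k', 8 * ℓ ≤ n * P.real (τ k') := by
    intro k'
    have : Nonempty (Fin K) := ⟨k⟩
    have h1 : (⨅ k', P.real (τ k')) ≤ P.real (τ k') := ciInf_le (Set.finite_range _).bddBelow k'
    have h2 : 0 < ⨅ k', P.real (τ k') := by
      obtain ⟨i, hi⟩ := exists_eq_ciInf_of_finite (f := fun k' => P.real (τ k'))
      rw [← hi]
      exact hp i
    rw [div_le_iff₀ h2] at hn1
    exact hn1.trans (by gcongr)
  choose G hGm hGp hG using fun k' => DPFair.exists_event_abs_accuracy_cond_sub_le hbias P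
    (hτ.measurableSet k') (hp k') hn (show DPFair.linDim 𝒳 ≤ L by linarith)
  set α := √(b * ℓ / n) with hα
  have hα0 : 0 < α := by positivity
  have hBad := (hChat α hα0).trans (DPFair.mul_exp_tail_le hB₄ hℓ1 hnpos)
  have hprob : IsProbabilityMeasure (DPFair.sampleLaw n P) := by
    unfold DPFair.sampleLaw; infer_instance
  obtain ⟨E, hEm, hEp, hE⟩ := DPFair.exists_measurableSet_of_sum_le (DPFair.sampleLaw n P) hGm
    {D | α < ∑ k' : Fin (K + 1), |C k k' - Chat D k k'|} (δ := κ) (by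
      calc _ ≤ ∑ _k' : Fin K, 2 * Real.exp (-ℓ) + Real.exp (-ℓ) := by
            gcongr with k'
            refine (hGp k').trans ?_
            have : Real.exp (-(n * P.real (τ k') / 8)) ≤ Real.exp (-ℓ) :=
              Real.exp_le_exp.2 (by linarith [hnp k'])
            linarith
        _ = κ := by
            rw [hexpℓ, Finset.sum_const, Finset.card_univ, Fintype.card_fin, nsmul_eq_mul]
            field_simp)
  refine ⟨E, hEm, hEp, fun D hD => ?_⟩
  obtain ⟨hDG, hDC⟩ := hE D hD
  have hDC : ∑ k' : Fin (K + 1), |C k k' - Chat D k k'| ≤ α := not_lt.1 hDC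
  set c := Chat D k with hc
  -- the estimated constants are bounded below in sum
  have hαs : α ≤ s / 2 := by
    rw [hα, Real.sqrt_le_left (by positivity), div_le_iff₀ hnpos]
    have h1 : b * ℓ = s ^ 2 / 4 * (4 * b / s ^ 2 * ℓ) := by field_simp
    rw [h1, div_pow]
    norm_num
    gcongr
  have hcs : s / 2 ≤ ∑ k' : Fin K, |c k'.succ| := by
    have h1 : ∑ k' : Fin K, |C k k'.succ| ≤
        ∑ k' : Fin K, |c k'.succ| + ∑ k' : Fin K, |C k k'.succ - c k'.succ| := by
      rw [← Finset.sum_add_distrib]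
      refine Finset.sum_le_sum fun k' _ => ?_
      have := abs_add_le (c k'.succ) (C k k'.succ - c k'.succ)
      rwa [add_sub_cancel] at this
    rw [Fin.sum_univ_succ] at hDC
    have := abs_nonneg (C k 0 - c 0)
    linarith
  have hp1 : ∀ k', P.real (τ k') ≤ 1 := fun k' => measureReal_le_one
  have hαbound : α ≤ 2 / s * √(3 * b) *
      ∑ k' : Fin K, |c k'.succ| * √(q / (n * P.real (τ k'))) := by
    have h1 : α ≤ √(3 * b) * √(q / n) := by
      rw [hα, ← Real.sqrt_mul (by positivity)]
      apply Real.sqrt_le_sqrt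
      rw [← mul_div_assoc]
      exact div_le_div_of_nonneg_right (by nlinarith) hnpos.le
    have h2 : s / 2 * √(q / n) ≤ ∑ k' : Fin K, |c k'.succ| * √(q / (n * P.real (τ k'))) := by
      calc s / 2 * √(q / n) ≤ (∑ k' : Fin K, |c k'.succ|) * √(q / n) := by gcongr
        _ = ∑ k' : Fin K, |c k'.succ| * √(q / n) := Finset.sum_mul _ _ _
        _ ≤ _ := by
            refine Finset.sum_le_sum fun k' _ => ?_
            have := hp k'
            gcongr
            exact mul_le_of_le_one_right hnpos.le (hp1 k')
    calc α ≤ √(3 * b) * √(q / n) := h1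
      _ = 2 / s * √(3 * b) * (s / 2 * √(q / n)) := by field_simp
      _ ≤ _ := by gcongr
  refine (DPFair.withProb_abs_fairness_sub_expFairness_le hbias c τ (M D) hσ hζ0
    (DPFair.empirical D)).mono fun ξ hξ => ?_
  have h1 := DPFair.abs_fairness_sub_le_sum_abs_sub (C k) c τ (M D + σ • ξ) P
  have h2 := DPFair.abs_fairness_sub_le_sum_mul c τ (M D + σ • ξ) P (DPFair.empirical D)
    (u := fun k' => 208 * √3 * √(q / (n * P.real (τ k')))) fun k' => by
      refine (hG k' D (hDG k') _).trans ?_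
      have := hp k'
      rw [mul_assoc, ← Real.sqrt_mul (by norm_num), ← mul_div_assoc]
      gcongr
  have h3 : ∑ k' : Fin K, |c k'.succ| * (208 * √3 * √(q / (n * P.real (τ k')))) =
      208 * √3 * ∑ k' : Fin K, |c k'.succ| * √(q / (n * P.real (τ k'))) := by
    rw [Finset.mul_sum]
    exact Finset.sum_congr rfl fun k' _ => by ring
  rw [h3] at h2
  rw [add_mul]
  have h4 := abs_add_three
    (DPFair.fairness (C k) τ (M D + σ • ξ) P - DPFair.fairness c τ (M D + σ • ξ) P)
    (DPFair.fairness c τ (M D + σ • ξ) P -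
      DPFair.fairness c τ (M D + σ • ξ) (DPFair.empirical D))
    (DPFair.fairness c τ (M D + σ • ξ) (DPFair.empirical D) -
      DPFair.expFairness c τ (M D) σ (DPFair.empirical D))
  rw [sub_add_sub_cancel, sub_add_sub_cancel] at h4
  linarith
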